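/- Let $n\ge 1$ be an integer and let $\mathcal N_0=\mathrm{Sym}^+(n,\mathbb R)$ be the open set of positive definite matrices in the vector space $\mathrm{Sym}(n,\mathbb R)$ of real symmetric $n\times n$ matrices; $\Sigma\in\mathcal N_0$ stands for the normal distribution $N(0,\Sigma)$ on $\mathbb R^n$, with density $p(x;\Sigma)$, and tangent vectors are identified with elements of $\mathrm{Sym}(n,\mathbb R)$. Let $$g^F_\Sigma(X,Y)=\int (X\log p)(Y\log p)\,p(x;\Sigma)\,dx,\qquad C^{A(\alpha)}_\Sigma(X,Y,Z)=\alpha\int (X\log p)(Y\log p)(Z\log p)\,p(x;\Sigma)\,dx$$ be the Fisher metric and the Amari--Chentsov $\alpha$-tensor. For a symmetric $(0,3)$-tensor field $C$ let $\nabla^{(g^F,C)}$ be the connection determined by $C(X,Y,Z)=-2g^F(\nabla_XY-\nabla^{g^F}_XY,Z)$, where $\nabla^{g^F}$ is the Levi-Civita connection, and put $\nabla^{A(\alpha)}=\nabla^{(g^F,C^{A(\alpha)})}$. Let $C'=C_1-\frac6nC_2+\frac4{n^2}C_3$ with $$C_1|_\Sigma(X,Y,Z)=\mathrm{tr}(\Sigma^{-1}X\Sigma^{-1}Y\Sigma^{-1}Z),\qquad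 C_3|_\Sigma(X,Y,Z)=\mathrm{tr}(\Sigma^{-1}X)\,\mathrm{tr}(\Sigma^{-1}Y)\,\mathrm{tr}(\Sigma^{-1}Z),$$ $$C_2|_\Sigma(X,Y,Z)=\tfrac13\bigl(\mathrm{tr}(\Sigma^{-1}X\Sigma^{-1}Y)\mathrm{tr}(\Sigma^{-1}Z)+\mathrm{tr}(\Sigma^{-1}Y\Sigma^{-1}Z)\mathrm{tr}(\Sigma^{-1}X)+\mathrm{tr}(\Sigma^{-1}Z\Sigma^{-1}X)\mathrm{tr}(\Sigma^{-1}Y)\bigr).$$ Let $\sigma_2(\Sigma)=(\det\Sigma)^{-2/n}\Sigma$, let $\Gamma(A,\Sigma)=A\Sigma\,{}^tA$ be the action of $GL(n,\mathbb R)$ on $\mathcal N_0$, and let $D_{\mathrm{KL}}(\Sigma_1,\Sigma_2)$ be the Kullback--Leibler divergence of $N(0,\Sigma_1)$ from $N(0,\Sigma_2)$. The canonical divergence of a Hessian structure $(g,\nabla)$ that has global $\nabla$-affine coordinates $(x^i)$ and a global potential $\varphi$ with $g=\nabla d\varphi$ is $D(p,q)=\sum_i(x^i(q)-x^i(p))\frac{\partial\varphi}{\partial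 x^i}(q)-(\varphi(q)-\varphi(p))$, provided that it does not depend on the choice of $(x^i)$ and $\varphi$. Then: 1. $(g^F,\nabla^{A(-1)})$ and $(g^F,\nabla^{(g^F,-C')})$ are Hessian (that is, dually flat) structures on $\mathcal N_0$. 2. $D_{\mathrm{KL}}(\Sigma_1,\Sigma_2)=\frac12\bigl(\mathrm{tr}(\Sigma_1\Sigma_2^{-1})-\log\det(\Sigma_1\Sigma_2^{-1})-n\bigr)$ for all $\Sigma_1,\Sigma_2\in\mathcal N_0$, and $D_{\mathrm{KL}}$ is the canonical divergence of $(g^F,\nabla^{A(-1)})$. 3. The canonical divergence of $(g^F,\nabla^{(g^F,-C')})$ is $D'=\sigma_2^*D_{\mathrm{KL}}$, that is, $D'(\Sigma_1,\Sigma_2)=D_{\mathrm{KL}}(\sigma_2(\Sigma_1),\sigma_2(\Sigma_2))$, and explicitly $$D'(\Sigma_1,\Sigma_2)=\tfrac12\bigl(\det(\Sigma_1\Sigma_2^{-1})^{-2/n}\,\mathrm{tr}(\Sigma_1\Sigma_2^{-1})-\log\det(\Sigma_1^{-1}\Sigma_2)-n\bigr).$$ 4. $(\mathcal N_0,g^F,\nabla^{A(-1)},GL(n,\mathbb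 R),\Gamma)$ and $(\mathcal N_0,g^F,\nabla^{(g^F,-C')},GL(n,\mathbb R),\Gamma)$ are homogeneous statistical manifolds (the Lie group acts smoothly and transitively and preserves the metric and the connection), and $\sigma_2$ induces an isomorphism from the first to the second in the category $\mathbf{HS}$. Here a morphism of $\mathbf{HS}$ is a pair $(\phi,f)$ of a Lie group homomorphism $\phi$ and a smooth map $f$ with $f(h\cdot x)=\phi(h)\cdot f(x)$ that is isometric and satisfies $g(\nabla_XY,Z)=g'((f^*\nabla')_Xf_*Y,f_*Z)$ for all vector fields $X,Y,Z$; the claim is that there is a Lie group homomorphism $\phi:GL(n,\mathbb R)\to GL(n,\mathbb R)$ such that $(\phi,\sigma_2)$ is an isomorphism of $\mathbf{HS}$. -/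

import Mathlib

open scoped Manifold ContDiff Matrix Matrix.Norms.L2Operator

noncomputable section

/-! ## Affine connections and statistical structures on open subsets of a vector space

`V` is a finite-dimensional real vector space and `U` an open subset of it, regarded as an open
submanifold; every tangent space of `U` is `V`. A vector field on `U` is a map `V → V` that is
smooth on `U`; its values off `U` are irrelevant, and the same holds for all tensor fields below. -/

namespace InfoGeom

section Connections

variable {V : Type*} [NormedAddCommGroup V] [NormedSpace ℝ V]

/-- Smooth vector fields on `U`. -/
def IsVectorField (U : Set V) (X : V → V) : Prop := ContDiffOn ℝ ∞ X U

/-- `g` is a (smooth) Riemannian metric on `U`. -/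
structure IsRiemannianMetric (U : Set V) (g : V → V → V → ℝ) : Prop where
  add_smul : ∀ p ∈ U, ∀ (a : ℝ) (x y z : V), g p (a • x + y) z = a * g p x z + g p y z
  symm : ∀ p ∈ U, ∀ x y : V, g p x y = g p y x
  pos : ∀ p ∈ U, ∀ x : V, x ≠ 0 → 0 < g p x x
  smooth : ∀ x y : V, ContDiffOn ℝ ∞ (fun p => g p x y) U

/-- The affine connections on the open set `U` are exactly the operators `∇ = d + Γ`, with `Γ` a
smooth field of bilinear maps; `Γ` is used to denote the connection. -/
structure IsAffineConnection (U : Set V) (Γ : V → V → V → V) : Prop where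
  add_smul_left : ∀ p ∈ U, ∀ (a : ℝ) (x y z : V), Γ p (a • x + y) z = a • Γ p x z + Γ p y z
  add_smul_right : ∀ p ∈ U, ∀ (a : ℝ) (x y z : V), Γ p z (a • x + y) = a • Γ p z x + Γ p z y
  smooth : ∀ x y : V, ContDiffOn ℝ ∞ (fun p => Γ p x y) U

/-- The covariant derivative `∇_X Y`. -/
def cov (Γ : V → V → V → V) (X Y : V → V) : V → V :=
  fun p => fderiv ℝ Y p (X p) + Γ p (X p) (Y p)

/-- The derivative `X h` of a function `h` along a vector field `X`. -/
def der (X : V → V) (h : V → ℝ) : V → ℝ := fun p => fderiv ℝ h p (X p)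

/-- The covariant derivative `(∇_X g)(Y, Z)` of a `(0,2)`-tensor field. -/
def covMetric (Γ : V → V → V → V) (g : V → V → V → ℝ) (X Y Z : V → V) : V → ℝ :=
  fun p => der X (fun q => g q (Y q) (Z q)) p
    - g p (cov Γ X Y p) (Z p) - g p (Y p) (cov Γ X Z p)

/-- Vanishing of the torsion: `∇_X Y - ∇_Y X = [X, Y]`. -/
def IsTorsionFree (U : Set V) (Γ : V → V → V → V) : Prop :=
  ∀ X Y : V → V, IsVectorField U X → IsVectorField U Y → ∀ p ∈ U,
    cov Γ X Y p - cov Γ Y X p = VectorField.lieBracket ℝ X Y p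

/-- Vanishing of the curvature tensor
`R(X, Y) Z = ∇_X ∇_Y Z - ∇_Y ∇_X Z - ∇_{[X, Y]} Z`. -/
def IsFlat (U : Set V) (Γ : V → V → V → V) : Prop :=
  ∀ X Y Z : V → V, IsVectorField U X → IsVectorField U Y → IsVectorField U Z → ∀ p ∈ U,
    cov Γ X (cov Γ Y Z) p - cov Γ Y (cov Γ X Z) p
      - cov Γ (VectorField.lieBracket ℝ X Y) Z p = 0

/-- `(U, g, ∇)` is a statistical manifold. -/
structure IsStatistical (U : Set V) (g : V → V → V → ℝ) (Γ : V → V → V → V) : Prop where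
  isOpen : IsOpen U
  metric : IsRiemannianMetric U g
  connection : IsAffineConnection U Γ
  torsionFree : IsTorsionFree U Γ
  codazzi : ∀ X Y Z : V → V, IsVectorField U X → IsVectorField U Y → IsVectorField U Z →
    ∀ p ∈ U, covMetric Γ g X Y Z p = covMetric Γ g Y X Z p

/-- `(U, g, ∇)` is a dually flat (equivalently, Hessian) manifold. -/
structure IsHessian (U : Set V) (g : V → V → V → ℝ) (Γ : V → V → V → V) : Prop
    extends IsStatistical U g Γ where
  flat : IsFlat U Γ

/-! ### The statistical connection with given cubic form -/

/-- The vector that represents the linear functional `ℓ` in the inner product `g p`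
(see `sharp_spec` and `eq_sharp`). -/
def sharp (g : V → V → V → ℝ) (p : V) (ℓ : V → ℝ) : V :=
  Classical.epsilon fun w => ∀ z, g p w z = ℓ z

/-- The Levi-Civita connection `∇^g`, by the Koszul formula for constant vector fields. -/
def leviCivita (g : V → V → V → ℝ) (p x y : V) : V :=
  sharp g p fun z => (1 / 2 : ℝ) *
    (fderiv ℝ (fun q => g q y z) p x + fderiv ℝ (fun q => g q x z) p y
      - fderiv ℝ (fun q => g q x y) p z)

/-- The cubic form `C^∇(X, Y, Z) = -2 g(∇_X Y - ∇^g_X Y, Z)`. -/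
def cubicForm (g : V → V → V → ℝ) (Γ : V → V → V → V) (p x y z : V) : ℝ :=
  -2 * g p (Γ p x y - leviCivita g p x y) z

/-- The connection `∇^(g, C)` with cubic form `C`, that is, the solution `∇` of
`-2 g(∇_X Y - ∇^g_X Y, Z) = C(X, Y, Z)` (see `cubicForm_eq_iff`). -/
def statConnection (g : V → V → V → ℝ) (C : V → V → V → V → ℝ) (p x y : V) : V :=
  leviCivita g p x y + sharp g p fun z => -(1 / 2 : ℝ) * C p x y z

theorem eq_sharp {U : Set V} {g : V → V → V → ℝ} (hg : IsRiemannianMetric U g) {p : V}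
    (hp : p ∈ U) {ℓ : V → ℝ} {w : V} (hw : ∀ z, g p w z = ℓ z) : w = sharp g p ℓ := by
  have hs : ∀ z, g p (sharp g p ℓ) z = ℓ z :=
    Classical.epsilon_spec (p := fun w => ∀ z, g p w z = ℓ z) ⟨w, hw⟩
  by_contra hne
  have hpos := hg.pos p hp (w - sharp g p ℓ) (sub_ne_zero.mpr hne)
  have h := hg.add_smul p hp (-1) (sharp g p ℓ) w (w - sharp g p ℓ)
  rw [hw, hs, show (-1 : ℝ) • sharp g p ℓ + w = w - sharp g p ℓ by
    rw [neg_one_smul]; abel] at h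
  linarith

theorem sharp_spec [FiniteDimensional ℝ V] {U : Set V} {g : V → V → V → ℝ}
    (hg : IsRiemannianMetric U g) {p : V} (hp : p ∈ U) {ℓ : V → ℝ} (hℓ : IsLinearMap ℝ ℓ)
    (z : V) : g p (sharp g p ℓ) z = ℓ z := by
  have hadd : ∀ x y z, g p (x + y) z = g p x z + g p y z := fun x y z => by
    simpa using hg.add_smul p hp 1 x y z
  have hsmul : ∀ (a : ℝ) x z, g p (a • x) z = a * g p x z := fun a x z => by
    have h0 : g p 0 z = 0 := by simpa using hg.add_smul p hp 1 0 0 z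
    simpa [h0] using hg.add_smul p hp a x 0 z
  let B : V →ₗ[ℝ] V →ₗ[ℝ] ℝ := LinearMap.mk₂ ℝ (g p) hadd hsmul
    (fun x y z => by
      rw [hg.symm p hp, hadd, hg.symm p hp y, hg.symm p hp z])
    (fun a x y => by rw [hg.symm p hp, hsmul, hg.symm p hp y]; rfl)
  have hB : Function.Injective B := by
    rw [injective_iff_map_eq_zero]
    intro x hx
    by_contra hne
    have h1 := hg.pos p hp x hne
    have h2 : B x x = 0 := by rw [hx]; rfl
    exact absurd h2 h1.ne'
  have hsurj : Function.Surjective B :=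
    (LinearMap.injective_iff_surjective_of_finrank_eq_finrank
      (by rw [Subspace.dual_finrank_eq (K := ℝ) (V := V)])).mp hB
  obtain ⟨w, hw⟩ := hsurj hℓ.mk'
  have hw' : ∀ z, g p w z = ℓ z := fun z => by
    have := LinearMap.congr_fun hw z
    exact this
  rw [← eq_sharp hg hp hw']
  exact hw' z

/-- `statConnection g C` is the only connection with cubic form `C`. -/
theorem cubicForm_eq_iff [FiniteDimensional ℝ V] {U : Set V} {g : V → V → V → ℝ}
    (hg : IsRiemannianMetric U g) {C : V → V → V → V → ℝ} {Γ : V → V → V → V} {p x y : V}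
    (hp : p ∈ U) (hC : IsLinearMap ℝ (C p x y)) :
    (∀ z, cubicForm g Γ p x y z = C p x y z) ↔ Γ p x y = statConnection g C p x y := by
  have hlin : IsLinearMap ℝ fun z => -(1 / 2 : ℝ) * C p x y z :=
    ⟨fun a b => by rw [hC.map_add]; ring, fun a b => by
      rw [hC.map_smul]; simp only [smul_eq_mul]; ring⟩
  constructor
  · intro h
    have : Γ p x y - leviCivita g p x y = sharp g p fun z => -(1 / 2 : ℝ) * C p x y z :=
      eq_sharp hg hp fun z => by rw [← h z, cubicForm]; ring
    rw [statConnection, ← this]; abel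
  · intro h z
    rw [cubicForm, h, statConnection, add_sub_cancel_left, sharp_spec hg hp hlin]; ring

/-! ### Canonical divergence of a Hessian structure -/

/-- `x` is a global `∇`-affine coordinate system on `U`: a diffeomorphism onto an open subset of
`V` (which is identified with `ℝ^(dim V)` by a linear isomorphism) whose components `x^i`
satisfy `∇ dx^i = 0`, that is, `X (Y x^i) = (∇_X Y) x^i`. -/
structure IsAffineCoordinates (U : Set V) (Γ : V → V → V → V) (x : V → V) : Prop where
  smooth : ContDiffOn ℝ ∞ x U
  injOn : Set.InjOn x U
  bijective_fderiv : ∀ p ∈ U, Function.Bijective (fderiv ℝ x p)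
  affine : ∀ X Y : V → V, IsVectorField U X → IsVectorField U Y → ∀ p ∈ U,
    fderiv ℝ (fun q => fderiv ℝ x q (Y q)) p (X p) = fderiv ℝ x p (cov Γ X Y p)

/-- `φ` is a global potential of `(g, ∇)` on `U`: `g = ∇ dφ`. -/
structure IsPotential (U : Set V) (g : V → V → V → ℝ) (Γ : V → V → V → V) (φ : V → ℝ) :
    Prop where
  smooth : ContDiffOn ℝ ∞ φ U
  hessian : ∀ X Y : V → V, IsVectorField U X → IsVectorField U Y → ∀ p ∈ U,
    der X (der Y φ) p - der (cov Γ X Y) φ p = g p (X p) (Y p)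

/-- The divergence `∑ᵢ (x^i(q) - x^i(p)) (∂φ/∂x^i)(q) - (φ(q) - φ(p))`: the vector
`∑ᵢ (x^i(q) - x^i(p)) ∂/∂x^i` at `q` is the inverse image of `x(q) - x(p)` under `dx_q`. -/
def coordDivergence (x : V → V) (φ : V → ℝ) (p q : V) : ℝ :=
  fderiv ℝ φ q ((fderiv ℝ x q).inverse (x q - x p)) - (φ q - φ p)

/-- `D` is the canonical divergence of the Hessian structure `(g, ∇)` on `U`: affine coordinates
and a potential exist, and `D` is the divergence for every choice of them. -/
def IsCanonicalDivergence (U : Set V) (g : V → V → V → ℝ) (Γ : V → V → V → V)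
    (D : V → V → ℝ) : Prop :=
  (∃ x, IsAffineCoordinates U Γ x) ∧ (∃ φ, IsPotential U g Γ φ) ∧
    ∀ x φ, IsAffineCoordinates U Γ x → IsPotential U g Γ φ →
      ∀ p ∈ U, ∀ q ∈ U, D p q = coordDivergence x φ p q

end Connections

/-! ### Homogeneous statistical manifolds and their morphisms -/

section Homogeneous

variable {V : Type*} [NormedAddCommGroup V] [NormedSpace ℝ V]
  {V' : Type*} [NormedAddCommGroup V'] [NormedSpace ℝ V']

/-- The covariant derivative `(f^*∇')_X (f_* Y)`, for the induced connection on the pullback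
bundle `f^* TU'`, of the section `f_* Y` of that bundle. -/
def pullbackCov (Γ' : V' → V' → V' → V') (f : V → V') (X Y : V → V) : V → V' :=
  fun p => fderiv ℝ (fun q => fderiv ℝ f q (Y q)) p (X p)
    + Γ' (f p) (fderiv ℝ f p (X p)) (fderiv ℝ f p (Y p))

/-- Statistical immersions `(U, g, ∇) → (U', g', ∇')`. -/
structure IsStatImmersion (U : Set V) (g : V → V → V → ℝ) (Γ : V → V → V → V)
    (U' : Set V') (g' : V' → V' → V' → ℝ) (Γ' : V' → V' → V' → V') (f : V → V') : Prop where
  mapsTo : Set.MapsTo f U U'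
  smooth : ContDiffOn ℝ ∞ f U
  isometric : ∀ p ∈ U, ∀ x y : V,
    g' (f p) (fderiv ℝ f p x) (fderiv ℝ f p y) = g p x y
  connection : ∀ X Y Z : V → V, IsVectorField U X → IsVectorField U Y → IsVectorField U Z →
    ∀ p ∈ U, g p (cov Γ X Y p) (Z p)
      = g' (f p) (pullbackCov Γ' f X Y p) (fderiv ℝ f p (Z p))

variable {E : Type*} [NormedAddCommGroup E] [NormedSpace ℝ E]
  {H : Type*} [TopologicalSpace H] (I : ModelWithCorners ℝ E H)
  {G : Type*} [TopologicalSpace G] [ChartedSpace H G] [Group G] [LieGroup I ∞ G]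
  {E' : Type*} [NormedAddCommGroup E'] [NormedSpace ℝ E']
  {H' : Type*} [TopologicalSpace H'] (I' : ModelWithCorners ℝ E' H')
  {G' : Type*} [TopologicalSpace G'] [ChartedSpace H' G'] [Group G'] [LieGroup I' ∞ G']

/-- `σ` is a smooth transitive action of the Lie group `G` on `U`. -/
structure IsTransitiveSmoothAction (U : Set V) (σ : G → V → V) : Prop where
  mapsTo : ∀ h, Set.MapsTo (σ h) U U
  one : ∀ p ∈ U, σ 1 p = p
  mul : ∀ h k, ∀ p ∈ U, σ (h * k) p = σ h (σ k p)
  smooth : ContMDiffOn (I.prod 𝓘(ℝ, V)) 𝓘(ℝ, V) ∞ (fun a : G × V => σ a.1 a.2)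
    (Set.univ ×ˢ U)
  transitive : ∀ p ∈ U, ∀ q ∈ U, ∃ h, σ h p = q

/-- `(U, g, ∇, G, σ)` is a homogeneous statistical manifold. -/
structure IsHomogeneousStat (U : Set V) (g : V → V → V → ℝ) (Γ : V → V → V → V)
    (σ : G → V → V) : Prop where
  stat : IsStatistical U g Γ
  action : IsTransitiveSmoothAction I U σ
  metric_invariant : ∀ h, ∀ p ∈ U, ∀ x y : V,
    g (σ h p) (fderiv ℝ (σ h) p x) (fderiv ℝ (σ h) p y) = g p x y
  connection_invariant : ∀ h, ∀ X Y : V → V, IsVectorField U X → IsVectorField U Y →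
    ∀ p ∈ U, fderiv ℝ (σ h) p (cov Γ X Y p) = pullbackCov Γ (σ h) X Y p

/-- Equivariant statistical immersions `(U, g, ∇, G, σ) → (U', g', ∇', G', σ')`, the morphisms of
the category `HS` of homogeneous statistical manifolds. -/
structure IsHSMorphism (U : Set V) (g : V → V → V → ℝ) (Γ : V → V → V → V) (σ : G → V → V)
    (U' : Set V') (g' : V' → V' → V' → ℝ) (Γ' : V' → V' → V' → V') (σ' : G' → V' → V')
    (φ : G →* G') (f : V → V') : Prop where
  smooth_hom : ContMDiff I I' ∞ φ
  immersion : IsStatImmersion U g Γ U' g' Γ' f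
  equivariant : ∀ h, ∀ p ∈ U, f (σ h p) = σ' (φ h) (f p)

/-- `(φ, f)` is an isomorphism of the category `HS` between two homogeneous statistical
manifolds: it is a morphism and has an inverse morphism. -/
def IsHSIso (U : Set V) (g : V → V → V → ℝ) (Γ : V → V → V → V) (σ : G → V → V)
    (U' : Set V') (g' : V' → V' → V' → ℝ) (Γ' : V' → V' → V' → V') (σ' : G' → V' → V')
    (φ : G →* G') (f : V → V') : Prop :=
  IsHomogeneousStat I U g Γ σ ∧ IsHomogeneousStat I' U' g' Γ' σ' ∧
    IsHSMorphism I I' U g Γ σ U' g' Γ' σ' φ f ∧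
    ∃ (ψ : G' →* G) (e : V' → V), IsHSMorphism I' I U' g' Γ' σ' U g Γ σ ψ e ∧
      ψ.comp φ = MonoidHom.id G ∧ φ.comp ψ = MonoidHom.id G' ∧
      (∀ p ∈ U, e (f p) = p) ∧ ∀ p ∈ U', f (e p) = p

end Homogeneous

/-! ## Zero-mean multivariate normal distributions -/

section Normal

open MeasureTheory

/-- The vector space `Sym(n, ℝ)`. -/
def Sym (n : ℕ) : Submodule ℝ (Matrix (Fin n) (Fin n) ℝ) where
  carrier := {A | A.IsSymm}
  add_mem' := fun ha hb => ha.add hb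
  zero_mem' := Matrix.isSymm_zero
  smul_mem' := fun c _ ha => ha.smul c

/-- The open subset `Sym⁺(n, ℝ)` of positive definite matrices in `Sym(n, ℝ)`, which is the
parameter space of the family `𝒩₀` and is identified with it. -/
def SymPos (n : ℕ) : Set (Sym n) := {S | (S : Matrix (Fin n) (Fin n) ℝ).PosDef}

variable {n : ℕ}

/-- The density `p(x; Σ)` of the normal distribution with mean `0` and covariance `Σ`. -/
def density (S : Sym n) (x : Fin n → ℝ) : ℝ :=
  (√((2 * Real.pi) ^ n * (S : Matrix (Fin n) (Fin n) ℝ).det))⁻¹ *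
    Real.exp (-(1 / 2 : ℝ) * (x ⬝ᵥ ((S : Matrix (Fin n) (Fin n) ℝ)⁻¹ *ᵥ x)))

/-- The derivative `X log p(x; ·)` at `Σ` along the tangent vector `X = d/dt|₀ (Σ + t X)`. -/
def score (S X : Sym n) (x : Fin n → ℝ) : ℝ :=
  lineDeriv ℝ (fun T : Sym n => Real.log (density T x)) S X

/-- The Fisher metric `g^F`. -/
def fisherMetric (S X Y : Sym n) : ℝ :=
  ∫ x : Fin n → ℝ, score S X x * score S Y x * density S x

/-- The Amari-Chentsov `α`-tensor field `C^A(α)`. -/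
def amariTensor (α : ℝ) (S X Y Z : Sym n) : ℝ :=
  α * ∫ x : Fin n → ℝ, score S X x * score S Y x * score S Z x * density S x

/-- The Amari-Chentsov `α`-connection `∇^A(α)`. -/
def amariConnection (α : ℝ) : Sym n → Sym n → Sym n → Sym n :=
  statConnection fisherMetric (amariTensor α)

/-- `Σ⁻¹ X`. -/
def invMul (S X : Sym n) : Matrix (Fin n) (Fin n) ℝ :=
  (S : Matrix (Fin n) (Fin n) ℝ)⁻¹ * (X : Matrix (Fin n) (Fin n) ℝ)

def tensorC1 (S X Y Z : Sym n) : ℝ := (invMul S X * invMul S Y * invMul S Z).trace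

def tensorC2 (S X Y Z : Sym n) : ℝ :=
  (1 / 3 : ℝ) * ((invMul S X * invMul S Y).trace * (invMul S Z).trace
    + (invMul S Y * invMul S Z).trace * (invMul S X).trace
    + (invMul S Z * invMul S X).trace * (invMul S Y).trace)

def tensorC3 (S X Y Z : Sym n) : ℝ :=
  (invMul S X).trace * (invMul S Y).trace * (invMul S Z).trace

/-- `C' = C₁ - (6/n) C₂ + (4/n²) C₃`. -/
def tensorC' (S X Y Z : Sym n) : ℝ :=
  tensorC1 S X Y Z - 6 / (n : ℝ) * tensorC2 S X Y Z + 4 / (n : ℝ) ^ 2 * tensorC3 S X Y Z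

/-- The connection `∇^(g^F, -C')`. -/
def dualConnection' : Sym n → Sym n → Sym n → Sym n :=
  statConnection fisherMetric fun S X Y Z => -tensorC' S X Y Z

/-- The action `Γ(A, Σ) = A Σ ᵗA` of `GL(n, ℝ)`. -/
def congruence (A : GL (Fin n) ℝ) (S : Sym n) : Sym n :=
  ⟨(A : Matrix (Fin n) (Fin n) ℝ) * S * (A : Matrix (Fin n) (Fin n) ℝ)ᵀ, by
    have hS : (S : Matrix (Fin n) (Fin n) ℝ)ᵀ = S := S.2
    change (_ * _ * _)ᵀ = _
    rw [Matrix.transpose_mul, Matrix.transpose_mul, Matrix.transpose_transpose, hS,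
      Matrix.mul_assoc]⟩

/-- The map `σ₂(Σ) = (det Σ)^(-2/n) Σ`. -/
def sigma2 (S : Sym n) : Sym n :=
  (S : Matrix (Fin n) (Fin n) ℝ).det ^ (-2 / (n : ℝ)) • S

/-- The normal distribution `N(0, Σ)` as a measure on `ℝⁿ`. -/
def normal (S : Sym n) : Measure (Fin n → ℝ) :=
  volume.withDensity fun x => ENNReal.ofReal (density S x)

/-- The Kullback-Leibler divergence `D_KL(Σ₁, Σ₂)` of `N(0, Σ₁)` from `N(0, Σ₂)`. -/
def klDivergence (S T : Sym n) : ℝ := (InformationTheory.klDiv (normal S) (normal T)).toReal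

end Normal

end InfoGeom

end

namespace InfoGeom

section Hessian

variable {V : Type*} [NormedAddCommGroup V] [NormedSpace ℝ V]
  {E : Type*} [NormedAddCommGroup E] [NormedSpace ℝ E]
  {U : Set V} {g : V → V → V → ℝ} {Γ : V → V → V → V}

theorem IsVectorField.contDiffAt {X : V → V} (hX : IsVectorField U X) (hU : IsOpen U) {p : V}
    (hp : p ∈ U) : ContDiffAt ℝ ∞ X p :=
  ContDiffOn.contDiffAt hX (hU.mem_nhds hp)

theorem IsVectorField.differentiableAt {X : V → V} (hX : IsVectorField U X) (hU : IsOpen U)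
    {p : V} (hp : p ∈ U) : DifferentiableAt ℝ X p :=
  (hX.contDiffAt hU hp).differentiableAt (by simp)

theorem isVectorField_const (v : V) : IsVectorField U fun _ => v := contDiffOn_const

theorem contDiffOn_fderiv_apply (hU : IsOpen U) {F : V → E} (hF : ContDiffOn ℝ ∞ F U)
    {X : V → V} (hX : IsVectorField U X) :
    ContDiffOn ℝ ∞ (fun q => fderiv ℝ F q (X q)) U :=
  (hF.fderiv_of_isOpen hU (by simp)).clm_apply hX

theorem fderiv_fderiv_apply (hU : IsOpen U) {F : V → E} (hF : ContDiffOn ℝ ∞ F U)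
    {Y : V → V} {p : V} (hp : p ∈ U) (hY : DifferentiableAt ℝ Y p) (v : V) :
    fderiv ℝ (fun q => fderiv ℝ F q (Y q)) p v
      = fderiv ℝ (fderiv ℝ F) p v (Y p) + fderiv ℝ F p (fderiv ℝ Y p v) := by
  have h1 : DifferentiableAt ℝ (fderiv ℝ F) p :=
    ((hF.fderiv_of_isOpen (m := ∞) hU (by simp)).contDiffAt (hU.mem_nhds hp)).differentiableAt
      (by simp)
  rw [fderiv_clm_apply h1 hY]
  simp [add_comm]

theorem fderiv_fderiv_symm (hU : IsOpen U) {F : V → E} (hF : ContDiffOn ℝ ∞ F U) {p : V}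
    (hp : p ∈ U) (v w : V) :
    fderiv ℝ (fderiv ℝ F) p v w = fderiv ℝ (fderiv ℝ F) p w v :=
  ((hF.contDiffAt (hU.mem_nhds hp)).isSymmSndFDerivAt
    (by rw [minSmoothness_of_isRCLikeNormedField]; exact WithTop.coe_le_coe.mpr le_top)).eq v w

theorem fderiv_lieBracket (hU : IsOpen U) {F : V → E} (hF : ContDiffOn ℝ ∞ F U)
    {X Y : V → V} (hX : IsVectorField U X) (hY : IsVectorField U Y) {p : V} (hp : p ∈ U) :
    fderiv ℝ (fun q => fderiv ℝ F q (Y q)) p (X p) - fderiv ℝ (fun q => fderiv ℝ F q (X q)) p (Y p)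
      = fderiv ℝ F p (VectorField.lieBracket ℝ X Y p) := by
  rw [fderiv_fderiv_apply hU hF hp (hY.differentiableAt hU hp),
    fderiv_fderiv_apply hU hF hp (hX.differentiableAt hU hp),
    fderiv_fderiv_symm hU hF hp (X p), VectorField.lieBracket, map_sub]
  abel

theorem IsVectorField.lieBracket (hU : IsOpen U) {X Y : V → V} (hX : IsVectorField U X)
    (hY : IsVectorField U Y) : IsVectorField U (VectorField.lieBracket ℝ X Y) :=
  (contDiffOn_fderiv_apply hU hY hX).sub (contDiffOn_fderiv_apply hU hX hY)

namespace IsAffineConnection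

variable (h : IsAffineConnection U Γ) {p : V}
include h

theorem add_left (hp : p ∈ U) (x y z : V) : Γ p (x + y) z = Γ p x z + Γ p y z := by
  simpa using h.add_smul_left p hp 1 x y z

theorem add_right (hp : p ∈ U) (x y z : V) : Γ p z (x + y) = Γ p z x + Γ p z y := by
  simpa using h.add_smul_right p hp 1 x y z

theorem smul_left (hp : p ∈ U) (a : ℝ) (x z : V) : Γ p (a • x) z = a • Γ p x z := by
  have h0 : Γ p 0 z = 0 := by simpa using h.add_smul_left p hp 1 0 0 z
  simpa [h0] using h.add_smul_left p hp a x 0 z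

theorem smul_right (hp : p ∈ U) (a : ℝ) (x z : V) : Γ p z (a • x) = a • Γ p z x := by
  have h0 : Γ p z 0 = 0 := by simpa using h.add_smul_right p hp 1 0 0 z
  simpa [h0] using h.add_smul_right p hp a x 0 z

theorem sub_left (hp : p ∈ U) (x y z : V) : Γ p (x - y) z = Γ p x z - Γ p y z := by
  rw [sub_eq_add_neg, h.add_left hp, ← neg_one_smul ℝ y, h.smul_left hp]
  simp [sub_eq_add_neg]

theorem isVectorField_apply [FiniteDimensional ℝ V] {X Y : V → V}
    (hX : IsVectorField U X) (hY : IsVectorField U Y) :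
    IsVectorField U fun p => Γ p (X p) (Y p) := by
  let b := Module.finBasis ℝ V
  have hexp : ∀ p ∈ U, Γ p (X p) (Y p) = ∑ i, ∑ j, b.coord i (X p) • b.coord j (Y p) •
      Γ p (b i) (b j) := by
    intro p hp
    let B : V →ₗ[ℝ] V →ₗ[ℝ] V := LinearMap.mk₂ ℝ (Γ p) (h.add_left hp) (h.smul_left hp)
      (fun x y z => h.add_right hp y z x) (fun a x y => h.smul_right hp a y x)
    change B (X p) (Y p) = ∑ i, ∑ j, _ • _ • B (b i) (b j)
    rw [← LinearMap.sum_repr_mul_repr_mul b b]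
    simp [Finsupp.sum_fintype]
  have hcoord : ∀ i, ∀ {Z : V → V}, IsVectorField U Z →
      ContDiffOn ℝ ∞ (fun p => b.coord i (Z p)) U := fun i Z hZ =>
    (LinearMap.toContinuousLinearMap (b.coord i)).contDiff.comp_contDiffOn hZ
  refine ContDiffOn.congr (ContDiffOn.sum fun i _ => ContDiffOn.sum fun j _ =>
    (hcoord i hX).smul ((hcoord j hY).smul (h.smooth (b i) (b j)))) hexp

theorem isVectorField_cov [FiniteDimensional ℝ V] (hU : IsOpen U) {X Y : V → V}
    (hX : IsVectorField U X) (hY : IsVectorField U Y) : IsVectorField U (cov Γ X Y) :=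
  (contDiffOn_fderiv_apply hU hY hX).add (h.isVectorField_apply hX hY)

theorem cov_sub (hp : p ∈ U) (X Y Z : V → V) :
    cov Γ (X - Y) Z p = cov Γ X Z p - cov Γ Y Z p := by
  simp only [cov, Pi.sub_apply, map_sub, h.sub_left hp]
  abel

end IsAffineConnection

theorem cov_congr_left {X X' Y : V → V} {p : V} (h : X p = X' p) :
    cov Γ X Y p = cov Γ X' Y p := by
  simp only [cov, h]

namespace IsAffineCoordinates

variable {x : V → V} (hx : IsAffineCoordinates U Γ x)
include hx

theorem fderiv_injective {p : V} (hp : p ∈ U) : Function.Injective (fderiv ℝ x p) :=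
  (hx.bijective_fderiv p hp).1

theorem hessian_eq (hU : IsOpen U) {p : V} (hp : p ∈ U) (v w : V) :
    fderiv ℝ (fderiv ℝ x) p v w = fderiv ℝ x p (Γ p v w) := by
  have h := hx.affine (fun _ => v) (fun _ => w) (isVectorField_const v) (isVectorField_const w) p hp
  rw [fderiv_fderiv_apply hU hx.smooth hp (differentiableAt_const w)] at h
  simpa [cov] using h

theorem isTorsionFree (hU : IsOpen U) : IsTorsionFree U Γ := by
  intro X Y hX hY p hp
  apply hx.fderiv_injective hp
  rw [map_sub, ← hx.affine X Y hX hY p hp, ← hx.affine Y X hY hX p hp,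
    fderiv_lieBracket hU hx.smooth hX hY hp]

theorem isFlat [FiniteDimensional ℝ V] (hU : IsOpen U) (hΓ : IsAffineConnection U Γ) :
    IsFlat U Γ := by
  intro X Y Z hX hY hZ p hp
  have key : ∀ X Y : V → V, IsVectorField U X → IsVectorField U Y →
      fderiv ℝ x p (cov Γ X (cov Γ Y Z) p)
        = fderiv ℝ (fun q => fderiv ℝ (fun r => fderiv ℝ x r (Z r)) q (Y q)) p (X p) := by
    intro X Y hX hY
    rw [← hx.affine X _ hX (hΓ.isVectorField_cov hU hY hZ) p hp]
    have : (fun q => fderiv ℝ x q (cov Γ Y Z q))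
        =ᶠ[nhds p] fun q => fderiv ℝ (fun r => fderiv ℝ x r (Z r)) q (Y q) := by
      filter_upwards [hU.mem_nhds hp] with q hq
      exact (hx.affine Y Z hY hZ q hq).symm
    rw [this.fderiv_eq]
  apply hx.fderiv_injective hp
  rw [map_sub, map_sub, key X Y hX hY, key Y X hY hX,
    ← hx.affine _ Z (hX.lieBracket hU hY) hZ p hp, map_zero,
    fderiv_lieBracket hU (contDiffOn_fderiv_apply hU hx.smooth hZ) hX hY hp, sub_self]

theorem isHessian [FiniteDimensional ℝ V] (hU : IsOpen U) (hg : IsRiemannianMetric U g)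
    (hΓ : IsAffineConnection U Γ) {φ : V → ℝ} (hφ : IsPotential U g Γ φ) :
    IsHessian U g Γ where
  isOpen := hU
  metric := hg
  connection := hΓ
  torsionFree := hx.isTorsionFree hU
  flat := hx.isFlat hU hΓ
  codazzi := by
    intro X Y Z hX hY hZ p hp
    have hmetric : ∀ Y : V → V, IsVectorField U Y → ∀ X : V → V, IsVectorField U X →
        der X (fun q => g q (Y q) (Z q)) p
          = der X (der Y (der Z φ)) p - der X (der (cov Γ Y Z) φ) p := by
      intro Y hY X hX
      have he : (fun q => g q (Y q) (Z q))
          =ᶠ[nhds p] (der Y (der Z φ)) - der (cov Γ Y Z) φ := by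
        filter_upwards [hU.mem_nhds hp] with q hq
        exact (hφ.hessian Y Z hY hZ q hq).symm
      have hd : ∀ {f : V → ℝ}, ContDiffOn ℝ ∞ f U → ∀ {W : V → V}, IsVectorField U W →
          DifferentiableAt ℝ (der W f) p := fun hf W hW =>
        ((contDiffOn_fderiv_apply hU hf hW).contDiffAt (hU.mem_nhds hp)).differentiableAt
          (by simp)
      rw [der, he.fderiv_eq, fderiv_sub (hd (f := der Z φ) (contDiffOn_fderiv_apply hU hφ.smooth hZ) hY)
        (hd hφ.smooth (hΓ.isVectorField_cov hU hY hZ))]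
      rfl
    have hc := hΓ.isVectorField_cov hU (X := X) (Y := Y) hX hY
    have hc' := hΓ.isVectorField_cov hU (X := Y) (Y := X) hY hX
    have hXZ := hΓ.isVectorField_cov hU (X := X) (Y := Z) hX hZ
    have hYZ := hΓ.isVectorField_cov hU (X := Y) (Y := Z) hY hZ
    have hT := hx.isTorsionFree hU X Y hX hY p hp
    have hR := hx.isFlat hU hΓ X Y Z hX hY hZ p hp
    have e1 := hφ.hessian _ Z hc hZ p hp
    have e2 := hφ.hessian _ Z hc' hZ p hp
    have e3 := hφ.hessian Y _ hY hXZ p hp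
    have e4 := hφ.hessian X _ hX hYZ p hp
    have hL : der X (der Y (der Z φ)) p - der Y (der X (der Z φ)) p
        = der (VectorField.lieBracket ℝ X Y) (der Z φ) p :=
      fderiv_lieBracket hU (contDiffOn_fderiv_apply hU hφ.smooth hZ) hX hY hp
    have hT1 : der (VectorField.lieBracket ℝ X Y) (der Z φ) p
        = der (cov Γ X Y) (der Z φ) p - der (cov Γ Y X) (der Z φ) p := by
      simp only [der, ← hT, map_sub]
    have hT2 : cov Γ (VectorField.lieBracket ℝ X Y) Z p
        = cov Γ (cov Γ X Y) Z p - cov Γ (cov Γ Y X) Z p := by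
      rw [← hΓ.cov_sub hp]
      exact cov_congr_left hT.symm
    have hR' : der (cov Γ X (cov Γ Y Z)) φ p - der (cov Γ Y (cov Γ X Z)) φ p
        = der (cov Γ (cov Γ X Y) Z) φ p - der (cov Γ (cov Γ Y X) Z) φ p := by
      simp only [der, ← map_sub, ← hT2]
      rw [sub_eq_zero.mp hR]
    have hs : g p (X p) (cov Γ Y Z p) = der X (der (cov Γ Y Z) φ) p
      - der (cov Γ X (cov Γ Y Z)) φ p := e4.symm
    have hs' : g p (Y p) (cov Γ X Z p) = der Y (der (cov Γ X Z) φ) p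
      - der (cov Γ Y (cov Γ X Z)) φ p := e3.symm
    rw [covMetric, covMetric, hmetric Y hY X hX, hmetric X hX Y hY, ← e1, ← e2, hs, hs']
    linarith

end IsAffineCoordinates

theorem isAffineCoordinates_of_hessian (hU : IsOpen U) {x : V → V} (hs : ContDiffOn ℝ ∞ x U)
    (hinj : Set.InjOn x U) (hbij : ∀ p ∈ U, Function.Bijective (fderiv ℝ x p))
    (h : ∀ p ∈ U, ∀ v w, fderiv ℝ (fderiv ℝ x) p v w = fderiv ℝ x p (Γ p v w)) :
    IsAffineCoordinates U Γ x where
  smooth := hs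
  injOn := hinj
  bijective_fderiv := hbij
  affine X Y _ hY p hp := by
    rw [fderiv_fderiv_apply hU hs hp (hY.differentiableAt hU hp), h p hp, cov, map_add, add_comm]

theorem isPotential_of_hessian (hU : IsOpen U) {φ : V → ℝ} (hs : ContDiffOn ℝ ∞ φ U)
    (h : ∀ p ∈ U, ∀ v w, fderiv ℝ (fderiv ℝ φ) p v w = fderiv ℝ φ p (Γ p v w) + g p v w) :
    IsPotential U g Γ φ where
  smooth := hs
  hessian X Y _ hY p hp := by
    have h' : der X (der Y φ) p = _ :=
      fderiv_fderiv_apply hU hs hp (hY.differentiableAt hU hp) (X p)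
    rw [h', h p hp, der, cov, map_add]
    ring

theorem IsPotential.hessian_eq (hU : IsOpen U) {φ : V → ℝ} (hφ : IsPotential U g Γ φ) {p : V}
    (hp : p ∈ U) (v w : V) :
    fderiv ℝ (fderiv ℝ φ) p v w = fderiv ℝ φ p (Γ p v w) + g p v w := by
  have h := hφ.hessian (fun _ => v) (fun _ => w) (isVectorField_const v) (isVectorField_const w) p hp
  have h' : der (fun _ => v) (der (fun _ => w) φ) p = _ :=
    fderiv_fderiv_apply hU hφ.smooth hp (differentiableAt_const w) v
  rw [h'] at h
  simp only [cov, der, fderiv_fun_const, Pi.zero_apply, zero_apply, map_zero,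
    add_zero, zero_add] at h
  linarith

/-- A curve in `U` along which the coordinates `x` are affine, with `c 0 = p` and `c 1 = q`. -/
structure IsGeodesicSegment (U : Set V) (x : V → V) (p q : V) (J : Set ℝ) (c : ℝ → V) : Prop where
  isOpen : IsOpen J
  Icc_subset : Set.Icc 0 1 ⊆ J
  mapsTo : Set.MapsTo c J U
  smooth : ContDiffOn ℝ ∞ c J
  coord : ∀ t ∈ J, x (c t) = x p + t • (x q - x p)
  zero : c 0 = p
  one : c 1 = q

theorem IsGeodesicSegment.hasDerivAt_comp (hU : IsOpen U) {x : V → V} {p q : V} {J : Set ℝ}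
    {c : ℝ → V} (hc : IsGeodesicSegment U x p q J c) {F : V → E} (hF : ContDiffOn ℝ ∞ F U)
    {t : ℝ} (ht : t ∈ J) :
    HasDerivAt (fun s => F (c s)) (fderiv ℝ F (c t) (deriv c t)) t := by
  have h := ((hF.contDiffAt (hU.mem_nhds (hc.mapsTo ht))).differentiableAt
    (by simp)).hasFDerivAt
  exact h.comp_hasDerivAt t
    ((hc.smooth.contDiffAt (hc.isOpen.mem_nhds ht)).differentiableAt (by simp)).hasDerivAt

theorem IsGeodesicSegment.hasDerivAt_fderiv_comp (hU : IsOpen U) {x : V → V} {p q : V}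
    {J : Set ℝ} {c : ℝ → V} (hc : IsGeodesicSegment U x p q J c) {F : V → E}
    (hF : ContDiffOn ℝ ∞ F U)
    (hD : ∀ p ∈ U, ∀ v w, fderiv ℝ (fderiv ℝ F) p v w = fderiv ℝ F p (Γ p v w))
    {t : ℝ} (ht : t ∈ J) :
    HasDerivAt (fun s => fderiv ℝ F (c s) (deriv c s))
      (fderiv ℝ F (c t) (Γ (c t) (deriv c t) (deriv c t) + deriv (deriv c) t)) t := by
  have h1 := hc.hasDerivAt_comp hU (hF.fderiv_of_isOpen (m := ∞) hU (by simp)) ht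
  have h2 := h1.clm_apply (((hc.smooth.deriv_of_isOpen (m := ∞) hc.isOpen (by simp)).contDiffAt
      (hc.isOpen.mem_nhds ht)).differentiableAt (by simp)).hasDerivAt
  rw [map_add, ← hD _ (hc.mapsTo ht)]
  exact h2

theorem IsGeodesicSegment.sub_eq_fderiv (hU : IsOpen U) {x : V → V}
    (hx : IsAffineCoordinates U Γ x) {p q : V} {J : Set ℝ} {c : ℝ → V}
    (hc : IsGeodesicSegment U x p q J c) {F : V → E} (hF : ContDiffOn ℝ ∞ F U)
    (hD : ∀ p ∈ U, ∀ v w, fderiv ℝ (fderiv ℝ F) p v w = fderiv ℝ F p (Γ p v w)) :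
    F q - F p = fderiv ℝ F q (deriv c 1) := by
  have hgeo : ∀ t ∈ J, Γ (c t) (deriv c t) (deriv c t) + deriv (deriv c) t = 0 := by
    intro t ht
    apply hx.fderiv_injective (hc.mapsTo ht)
    rw [map_zero]
    refine (hc.hasDerivAt_fderiv_comp hU hx.smooth (fun p hp => hx.hessian_eq hU hp) ht).unique ?_
    have hconst : (fun s => fderiv ℝ x (c s) (deriv c s)) =ᶠ[nhds t] fun _ => x q - x p := by
      filter_upwards [hc.isOpen.mem_nhds ht] with s hs
      refine (hc.hasDerivAt_comp hU hx.smooth hs).unique ?_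
      have hl : HasDerivAt (fun r : ℝ => x p + r • (x q - x p)) (x q - x p) s := by
        simpa using ((hasDerivAt_id s).smul_const (x q - x p)).const_add (x p)
      refine hl.congr_of_eventuallyEq ?_
      filter_upwards [hc.isOpen.mem_nhds hs] with r hr using hc.coord r hr
    exact (hasDerivAt_const t _).congr_of_eventuallyEq hconst
  have hslope : ∀ t ∈ Set.Icc (0 : ℝ) 1,
      fderiv ℝ F (c t) (deriv c t) = fderiv ℝ F (c 0) (deriv c 0) := by
    have hd : ∀ t ∈ Set.Icc (0 : ℝ) 1,
        HasDerivAt (fun s => fderiv ℝ F (c s) (deriv c s)) 0 t := by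
      intro t ht
      simpa [hgeo t (hc.Icc_subset ht)] using hc.hasDerivAt_fderiv_comp hU hF hD (hc.Icc_subset ht)
    exact constant_of_derivWithin_zero
      (fun t ht => (hd t ht).differentiableAt.differentiableWithinAt)
      (fun t ht => (hd t ⟨ht.1, ht.2.le⟩).hasDerivWithinAt.derivWithin
        (uniqueDiffOn_Icc zero_lt_one t ⟨ht.1, ht.2.le⟩))
  have hlin : ∀ t ∈ Set.Icc (0 : ℝ) 1, HasDerivAt
      (fun s => F (c s) - s • fderiv ℝ F (c 0) (deriv c 0)) 0 t := by
    intro t ht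
    have h1 := (hc.hasDerivAt_comp hU hF (hc.Icc_subset ht)).fun_sub
      ((hasDerivAt_id t).smul_const (fderiv ℝ F (c 0) (deriv c 0)))
    rw [hslope t ht] at h1
    simpa using h1
  have hend := constant_of_derivWithin_zero
      (fun t ht => (hlin t ht).differentiableAt.differentiableWithinAt)
      (fun t ht => (hlin t ⟨ht.1, ht.2.le⟩).hasDerivWithinAt.derivWithin
        (uniqueDiffOn_Icc zero_lt_one t ⟨ht.1, ht.2.le⟩)) 1 (Set.right_mem_Icc.mpr zero_le_one)
  have h1 := hslope 1 (Set.right_mem_Icc.mpr zero_le_one)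
  simp only [hc.zero, hc.one, one_smul, zero_smul, sub_zero] at hend h1
  rw [h1, ← hend]
  abel

theorem inverse_fderiv_apply_eq [FiniteDimensional ℝ V] {L : V →L[ℝ] V}
    (hL : Function.Bijective L) {v w : V} (h : L v = w) : L.inverse w = v := by
  let e : V ≃L[ℝ] V := (LinearEquiv.ofBijective (L : V →ₗ[ℝ] V) hL).toContinuousLinearEquiv
  have he : L = (e : V →L[ℝ] V) := by ext; rfl
  rw [he, ContinuousLinearMap.inverse_equiv, ← h, he]
  simp

theorem coordDivergence_eq_of_geodesic [FiniteDimensional ℝ V] (hU : IsOpen U) {x y : V → V}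
    {φ ψ : V → ℝ} (hx : IsAffineCoordinates U Γ x) (hy : IsAffineCoordinates U Γ y)
    (hφ : IsPotential U g Γ φ) (hψ : IsPotential U g Γ ψ) {p q : V} (hq : q ∈ U) {J : Set ℝ}
    {c : ℝ → V} (hc : IsGeodesicSegment U x p q J c) :
    coordDivergence y ψ p q = coordDivergence x φ p q := by
  have hex := hc.sub_eq_fderiv hU hx hx.smooth (fun p hp => hx.hessian_eq hU hp)
  have hey := hc.sub_eq_fderiv hU hx hy.smooth (fun p hp => hy.hessian_eq hU hp)
  have hd : ∀ r ∈ U, fderiv ℝ (ψ - φ) r = fderiv ℝ ψ r - fderiv ℝ φ r := fun r hr =>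
    fderiv_sub ((hψ.smooth.contDiffAt (hU.mem_nhds hr)).differentiableAt (by simp))
      ((hφ.smooth.contDiffAt (hU.mem_nhds hr)).differentiableAt (by simp))
  have hdd : ∀ r ∈ U, ∀ v w,
      fderiv ℝ (fderiv ℝ (ψ - φ)) r v w = fderiv ℝ (ψ - φ) r (Γ r v w) := by
    intro r hr v w
    have he : fderiv ℝ (ψ - φ) =ᶠ[nhds r] fderiv ℝ ψ - fderiv ℝ φ := by
      filter_upwards [hU.mem_nhds hr] with s hs using hd s hs
    have hdif : ∀ {f : V → ℝ}, ContDiffOn ℝ ∞ f U → DifferentiableAt ℝ (fderiv ℝ f) r :=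
      fun hf => ((hf.fderiv_of_isOpen (m := ∞) hU (by simp)).contDiffAt
        (hU.mem_nhds hr)).differentiableAt (by simp)
    rw [he.fderiv_eq, fderiv_sub (hdif hψ.smooth) (hdif hφ.smooth), hd r hr]
    simp only [sub_apply, hψ.hessian_eq hU hr, hφ.hessian_eq hU hr]
    ring
  have heφ := hc.sub_eq_fderiv (F := ψ - φ) hU hx (hψ.smooth.sub hφ.smooth) hdd
  rw [hd q hq] at heφ
  simp only [Pi.sub_apply, sub_apply] at heφ
  rw [coordDivergence, coordDivergence,
    inverse_fderiv_apply_eq (hx.bijective_fderiv q hq) hex.symm,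
    inverse_fderiv_apply_eq (hy.bijective_fderiv q hq) hey.symm]
  linarith

theorem isCanonicalDivergence_of_geodesics [FiniteDimensional ℝ V] (hU : IsOpen U) {x : V → V}
    {φ : V → ℝ} (hx : IsAffineCoordinates U Γ x) (hφ : IsPotential U g Γ φ)
    (hc : ∀ p ∈ U, ∀ q ∈ U, ∃ J c, IsGeodesicSegment U x p q J c) {D : V → V → ℝ}
    (hD : ∀ p ∈ U, ∀ q ∈ U, D p q = coordDivergence x φ p q) :
    IsCanonicalDivergence U g Γ D := by
  refine ⟨⟨x, hx⟩, ⟨φ, hφ⟩, fun y ψ hy hψ p hp q hq => ?_⟩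
  obtain ⟨J, c, h⟩ := hc p hp q hq
  rw [hD p hp q hq, coordDivergence_eq_of_geodesic hU hx hy hφ hψ hq h]

end Hessian

section MatrixCalculus

variable {n : ℕ}

theorem isOpen_symPos : IsOpen (SymPos n) := by
  rw [isOpen_iff_mem_nhds]
  intro S hS
  have hcont : Continuous fun z : Sym n × EuclideanSpace ℝ (Fin n) =>
      (z.2.ofLp ⬝ᵥ ((z.1 : Matrix (Fin n) (Fin n) ℝ) *ᵥ z.2.ofLp) : ℝ) := by
    fun_prop
  have hev := (isCompact_sphere (0 : EuclideanSpace ℝ (Fin n)) 1).eventually_forall_of_forall_eventually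
    (x₀ := S) (P := fun T x =>
      0 < x.ofLp ⬝ᵥ ((T : Matrix (Fin n) (Fin n) ℝ) *ᵥ x.ofLp)) (by
    intro x hx
    refine (hcont.continuousAt (x := (S, x))).eventually (lt_mem_nhds ?_)
    have hx0 : x.ofLp ≠ 0 := by
      intro h
      have : x = 0 := by ext i; simp [h]
      simp [this] at hx
    simpa using hS.dotProduct_mulVec_pos hx0)
  filter_upwards [hev] with T hT
  refine Matrix.PosDef.of_dotProduct_mulVec_pos (by
    rw [Matrix.IsHermitian, Matrix.conjTranspose_eq_transpose_of_trivial]; exact T.2) ?_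
  intro x hx
  have hx' : (WithLp.toLp 2 x : EuclideanSpace ℝ (Fin n)) ≠ 0 := by
    intro h; exact hx (by simpa using congrArg WithLp.ofLp h)
  have hn := norm_pos_iff.mpr hx'
  have h := hT (‖(WithLp.toLp 2 x : EuclideanSpace ℝ (Fin n))‖⁻¹ • WithLp.toLp 2 x) (by
    simp [norm_smul, hn.ne'])
  simp only [WithLp.ofLp_smul, Matrix.mulVec_smul, smul_dotProduct, dotProduct_smul,
    smul_eq_mul] at h
  have := (pos_iff_pos_of_mul_pos h).mp (inv_pos.mpr hn)
  simpa using (pos_iff_pos_of_mul_pos this).mp (inv_pos.mpr hn)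

theorem convex_symPos : Convex ℝ (SymPos n) := by
  intro S hS T hT a b ha hb hab
  rcases ha.eq_or_lt with rfl | ha
  · obtain rfl : b = 1 := by linarith
    simpa using hT
  · exact (Matrix.PosDef.smul hS ha).add_posSemidef (hT.posSemidef.smul hb)

theorem det_pos_of_mem {S : Sym n} (hS : S ∈ SymPos n) :
    0 < (S : Matrix (Fin n) (Fin n) ℝ).det := Matrix.PosDef.det_pos hS

theorem isUnit_det_of_mem {S : Sym n} (hS : S ∈ SymPos n) :
    IsUnit (S : Matrix (Fin n) (Fin n) ℝ).det := (det_pos_of_mem hS).ne'.isUnit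

theorem Sym.transpose_coe (S : Sym n) :
    (S : Matrix (Fin n) (Fin n) ℝ)ᵀ = S := S.2

theorem Sym.transpose_inv_coe (S : Sym n) :
    (S : Matrix (Fin n) (Fin n) ℝ)⁻¹ᵀ = (S : Matrix (Fin n) (Fin n) ℝ)⁻¹ := by
  rw [Matrix.transpose_nonsing_inv, Sym.transpose_coe]

theorem invMul_add (S X Y : Sym n) : invMul S (X + Y) = invMul S X + invMul S Y := by
  simp [invMul, mul_add]

theorem invMul_sub (S X Y : Sym n) : invMul S (X - Y) = invMul S X - invMul S Y := by
  simp [invMul, mul_sub]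

theorem invMul_zero (S : Sym n) : invMul S 0 = 0 := by
  simp [invMul]

theorem invMul_smul (S : Sym n) (a : ℝ) (X : Sym n) : invMul S (a • X) = a • invMul S X := by
  simp [invMul]

theorem invMul_self {S : Sym n} (hS : S ∈ SymPos n) : invMul S S = 1 :=
  Matrix.nonsing_inv_mul _ (isUnit_det_of_mem hS)

theorem mul_invMul {S : Sym n} (hS : S ∈ SymPos n) (X : Sym n) :
    (S : Matrix (Fin n) (Fin n) ℝ) * invMul S X = X :=
  Matrix.mul_nonsing_inv_cancel_left _ _ (isUnit_det_of_mem hS)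

theorem invMul_smul_left (c : ℝ) (S X : Sym n) : invMul (c • S) X = c⁻¹ • invMul S X := by
  rcases eq_or_ne c 0 with rfl | hc
  · simp [invMul, Matrix.inv_zero]
  by_cases h : IsUnit (S : Matrix (Fin n) (Fin n) ℝ).det
  · have : ((c • S : Sym n) : Matrix (Fin n) (Fin n) ℝ)⁻¹
        = c⁻¹ • (S : Matrix (Fin n) (Fin n) ℝ)⁻¹ := by
      apply Matrix.inv_eq_left_inv
      simp [Matrix.nonsing_inv_mul _ h, hc]
    rw [invMul, this, Matrix.smul_mul, invMul]
  · rcases Nat.eq_zero_or_pos n with rfl | hn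
    · ext i; exact i.elim0
    have h' : ¬ IsUnit ((c • S : Sym n) : Matrix (Fin n) (Fin n) ℝ).det := by
      simpa [Matrix.det_smul, hc] using h
    rw [invMul, invMul, Matrix.nonsing_inv_apply_not_isUnit _ h,
      Matrix.nonsing_inv_apply_not_isUnit _ h', zero_mul, smul_zero]

/-- Traces of products of the `Σ⁻¹ X` may be reversed. -/
theorem trace_invMul_mul_reverse (S X Y Z : Sym n) :
    (invMul S X * invMul S Y * invMul S Z).trace
      = (invMul S Y * invMul S X * invMul S Z).trace := by
  rw [← Matrix.trace_transpose]
  simp only [invMul, Matrix.transpose_mul, Sym.transpose_coe, Sym.transpose_inv_coe]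
  rw [← Matrix.mul_assoc, Matrix.trace_mul_comm]
  simp only [← Matrix.mul_assoc]
  rw [Matrix.trace_mul_comm]
  simp only [← Matrix.mul_assoc]
  rw [Matrix.trace_mul_comm, ← Matrix.mul_assoc, ← Matrix.mul_assoc, Matrix.trace_mul_comm]
  simp only [← Matrix.mul_assoc]

/-! ### Derivatives -/

theorem contDiff_coe : ContDiff ℝ ∞ fun S : Sym n => (S : Matrix (Fin n) (Fin n) ℝ) :=
  (Sym n).subtypeL.contDiff

theorem contDiffOn_inv :
    ContDiffOn ℝ ∞ (fun S : Sym n => (S : Matrix (Fin n) (Fin n) ℝ)⁻¹) (SymPos n) := by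
  intro S hS
  apply ContDiffAt.contDiffWithinAt
  simp only [Matrix.nonsing_inv_eq_ringInverse]
  obtain ⟨u, hu⟩ := Matrix.PosDef.isUnit hS
  have := contDiffAt_ringInverse (n := ∞) ℝ u
  rw [hu] at this
  exact this.comp S contDiff_coe.contDiffAt

theorem contDiffOn_invMul {X : Sym n → Sym n} (hX : ContDiffOn ℝ ∞ X (SymPos n)) :
    ContDiffOn ℝ ∞ (fun S : Sym n => invMul S (X S)) (SymPos n) :=
  contDiffOn_inv.mul (contDiff_coe.comp_contDiffOn hX)

theorem contDiff_trace :
    ContDiff ℝ ∞ fun A : Matrix (Fin n) (Fin n) ℝ => A.trace :=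
  (LinearMap.toContinuousLinearMap (Matrix.traceLinearMap (Fin n) ℝ ℝ)).contDiff

theorem contDiff_apply_apply (i j : Fin n) :
    ContDiff ℝ ∞ fun A : Matrix (Fin n) (Fin n) ℝ => A i j :=
  (LinearMap.toContinuousLinearMap (Matrix.entryLinearMap ℝ ℝ i j)).contDiff

theorem contDiff_det :
    ContDiff ℝ ∞ fun A : Matrix (Fin n) (Fin n) ℝ => A.det := by
  simp only [Matrix.det_apply]
  exact ContDiff.sum fun σ _ => (contDiff_prod fun i _ => contDiff_apply_apply _ _).const_smul _

theorem hasDerivAt_line {V : Type*} [NormedAddCommGroup V] [NormedSpace ℝ V] (p v : V) :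
    HasDerivAt (fun t : ℝ => p + t • v) v 0 := by
  simpa using ((hasDerivAt_id (0 : ℝ)).smul_const v).const_add p

theorem hasDerivAt_comp_line {V E : Type*} [NormedAddCommGroup V] [NormedSpace ℝ V]
    [NormedAddCommGroup E] [NormedSpace ℝ E] {f : V → E} {p : V} (hf : DifferentiableAt ℝ f p)
    (v : V) : HasDerivAt (fun t : ℝ => f (p + t • v)) (fderiv ℝ f p v) 0 := by
  have h : HasFDerivAt f (fderiv ℝ f p) (p + (0 : ℝ) • v) := by simpa using hf.hasFDerivAt
  exact h.comp_hasDerivAt 0 (hasDerivAt_line p v)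

theorem fderiv_apply_eq_of_hasDerivAt {V E : Type*} [NormedAddCommGroup V] [NormedSpace ℝ V]
    [NormedAddCommGroup E] [NormedSpace ℝ E] {U : Set V} (hU : IsOpen U) {f : V → E}
    (hf : ContDiffOn ℝ ∞ f U) {p : V} (hp : p ∈ U) {v : V} {y : E}
    (h : HasDerivAt (fun t : ℝ => f (p + t • v)) y 0) : fderiv ℝ f p v = y :=
  (hasDerivAt_comp_line ((hf.contDiffAt (hU.mem_nhds hp)).differentiableAt (by simp)) v).unique h

theorem hasDerivAt_inv_line {S : Sym n} (hS : S ∈ SymPos n) (X : Sym n) :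
    HasDerivAt (fun t : ℝ => ((S + t • X : Sym n) : Matrix (Fin n) (Fin n) ℝ)⁻¹)
      (-((S : Matrix (Fin n) (Fin n) ℝ)⁻¹ * X * (S : Matrix (Fin n) (Fin n) ℝ)⁻¹)) 0 := by
  obtain ⟨u, hu⟩ := Matrix.PosDef.isUnit hS
  have h1 := hasFDerivAt_ringInverse (𝕜 := ℝ) u
  have h2 : HasDerivAt (fun t : ℝ => ((S + t • X : Sym n) : Matrix (Fin n) (Fin n) ℝ)) X 0 :=
    hasDerivAt_line (S : Matrix (Fin n) (Fin n) ℝ) X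
  simp only [Matrix.nonsing_inv_eq_ringInverse]
  have h3 : HasFDerivAt Ring.inverse
      (-ContinuousLinearMap.mulLeftRight ℝ (Matrix (Fin n) (Fin n) ℝ) ↑u⁻¹ ↑u⁻¹) ((S + (0 : ℝ) • X : Sym n) : Matrix (Fin n) (Fin n) ℝ) := by
    simpa [← hu] using h1
  have h4 := h3.comp_hasDerivAt 0 h2
  refine h4.congr_deriv ?_
  simp [← hu]

theorem hasDerivAt_invMul_line {S : Sym n} (hS : S ∈ SymPos n) (X Y : Sym n) :
    HasDerivAt (fun t : ℝ => invMul (S + t • X) Y) (-(invMul S X * invMul S Y)) 0 := by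
  have := (hasDerivAt_inv_line hS X).mul_const (Y : Matrix (Fin n) (Fin n) ℝ)
  simpa [invMul, Matrix.mul_assoc] using this

theorem HasDerivAt.trace {f : ℝ → Matrix (Fin n) (Fin n) ℝ} {f' : Matrix (Fin n) (Fin n) ℝ}
    {t : ℝ} (hf : HasDerivAt f f' t) : HasDerivAt (fun t => (f t).trace) f'.trace t :=
  (LinearMap.toContinuousLinearMap (Matrix.traceLinearMap (Fin n) ℝ ℝ)).hasFDerivAt.comp_hasDerivAt
    t hf

theorem hasDerivAt_trace_invMul_line {S : Sym n} (hS : S ∈ SymPos n) (X Y : Sym n) :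
    HasDerivAt (fun t : ℝ => (invMul (S + t • X) Y).trace)
      (-(invMul S X * invMul S Y).trace) 0 := by
  simpa using HasDerivAt.trace (hasDerivAt_invMul_line hS X Y)

theorem hasDerivAt_trace_invMul_mul_line {S : Sym n} (hS : S ∈ SymPos n) (X Y Z : Sym n) :
    HasDerivAt (fun t : ℝ => (invMul (S + t • X) Y * invMul (S + t • X) Z).trace)
      (-2 * (invMul S X * invMul S Y * invMul S Z).trace) 0 := by
  have := HasDerivAt.trace ((hasDerivAt_invMul_line hS X Y).fun_mul (hasDerivAt_invMul_line hS X Z))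
  convert this using 1
  simp only [zero_smul, add_zero, Matrix.trace_add, neg_mul, mul_neg, Matrix.trace_neg,
    ← Matrix.mul_assoc]
  rw [trace_invMul_mul_reverse S Y X Z]
  ring

theorem hasDerivAt_det_line {S : Sym n} (hS : S ∈ SymPos n) (X : Sym n) :
    HasDerivAt (fun t : ℝ => ((S + t • X : Sym n) : Matrix (Fin n) (Fin n) ℝ).det)
      ((S : Matrix (Fin n) (Fin n) ℝ).det * (invMul S X).trace) 0 := by
  have h : ∀ t : ℝ, ((S + t • X : Sym n) : Matrix (Fin n) (Fin n) ℝ).det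
      = (S : Matrix (Fin n) (Fin n) ℝ).det *
        (1 + (invMul S X).trace * t + (Polynomial.eval t
          (Matrix.det (1 + (Polynomial.X : Polynomial ℝ) •
            (invMul S X).map Polynomial.C)).divX.divX) * t ^ 2) := by
    intro t
    rw [← Matrix.det_one_add_smul, ← Matrix.det_mul, mul_add, mul_one, Matrix.mul_smul,
      mul_invMul hS]
    rfl
  simp only [h]
  apply HasDerivAt.const_mul
  set P := (Matrix.det (1 + (Polynomial.X : Polynomial ℝ) •
            (invMul S X).map Polynomial.C)).divX.divX
  have h1 := ((hasDerivAt_id (0 : ℝ)).const_mul (invMul S X).trace).const_add 1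
  have h2 := (P.hasDerivAt 0).mul (hasDerivAt_pow 2 (0 : ℝ))
  simpa using h1.fun_add h2

theorem hasDerivAt_log_det_line {S : Sym n} (hS : S ∈ SymPos n) (X : Sym n) :
    HasDerivAt (fun t : ℝ => Real.log ((S + t • X : Sym n) : Matrix (Fin n) (Fin n) ℝ).det)
      (invMul S X).trace 0 := by
  have h := (hasDerivAt_det_line hS X).log (by simpa using (det_pos_of_mem hS).ne')
  convert h using 1
  simp [(det_pos_of_mem hS).ne']

theorem hasDerivAt_det_rpow_line {S : Sym n} (hS : S ∈ SymPos n) (X : Sym n) (r : ℝ) :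
    HasDerivAt (fun t : ℝ => ((S + t • X : Sym n) : Matrix (Fin n) (Fin n) ℝ).det ^ r)
      ((S : Matrix (Fin n) (Fin n) ℝ).det ^ r * (r * (invMul S X).trace)) 0 := by
  have h := (hasDerivAt_det_line hS X).rpow_const (p := r)
    (Or.inl (by simpa using (det_pos_of_mem hS).ne'))
  convert h using 1
  simp only [zero_smul, add_zero]
  rw [Real.rpow_sub_one (det_pos_of_mem hS).ne']
  have := (det_pos_of_mem hS).ne'
  field_simp

theorem contDiffOn_det : ContDiffOn ℝ ∞
    (fun S : Sym n => (S : Matrix (Fin n) (Fin n) ℝ).det) (SymPos n) :=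
  (contDiff_det.comp contDiff_coe).contDiffOn

theorem contDiffOn_det_rpow (r : ℝ) : ContDiffOn ℝ ∞
    (fun S : Sym n => (S : Matrix (Fin n) (Fin n) ℝ).det ^ r) (SymPos n) :=
  contDiffOn_det.rpow_const_of_ne fun _ hS => (det_pos_of_mem hS).ne'

theorem contDiffOn_sigma2 : ContDiffOn ℝ ∞ (sigma2 (n := n)) (SymPos n) :=
  (contDiffOn_det_rpow _).smul contDiffOn_id

/-! ### The map `σ₂` -/

theorem sigma2_mem {S : Sym n} (hS : S ∈ SymPos n) : sigma2 S ∈ SymPos n :=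
  Matrix.PosDef.smul hS (Real.rpow_pos_of_pos (det_pos_of_mem hS) _)

theorem det_sigma2 (hn : 1 ≤ n) {S : Sym n} (hS : S ∈ SymPos n) :
    (sigma2 S : Matrix (Fin n) (Fin n) ℝ).det = (S : Matrix (Fin n) (Fin n) ℝ).det⁻¹ := by
  have hn' : (n : ℝ) ≠ 0 := by positivity
  have hd := det_pos_of_mem hS
  have : (sigma2 S : Matrix (Fin n) (Fin n) ℝ)
      = (S : Matrix (Fin n) (Fin n) ℝ).det ^ (-2 / (n : ℝ)) • (S : Matrix (Fin n) (Fin n) ℝ) := rfl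
  rw [this, Matrix.det_smul, Fintype.card_fin, ← Real.rpow_natCast, ← Real.rpow_mul hd.le,
    div_mul_cancel₀ _ hn', Real.rpow_neg hd.le]
  norm_num
  field_simp

theorem sigma2_sigma2 (hn : 1 ≤ n) {S : Sym n} (hS : S ∈ SymPos n) : sigma2 (sigma2 S) = S := by
  have hd := det_pos_of_mem hS
  rw [sigma2, det_sigma2 hn hS, sigma2, smul_smul, Real.inv_rpow hd.le,
    inv_mul_cancel₀ (Real.rpow_pos_of_pos hd _).ne', one_smul]

theorem fderiv_sigma2_apply {S : Sym n} (hS : S ∈ SymPos n) (X : Sym n) :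
    fderiv ℝ sigma2 S X = (S : Matrix (Fin n) (Fin n) ℝ).det ^ (-2 / (n : ℝ)) •
      (X - (2 / (n : ℝ) * (invMul S X).trace) • S) := by
  apply fderiv_apply_eq_of_hasDerivAt isOpen_symPos contDiffOn_sigma2 hS
  have h := (hasDerivAt_det_rpow_line hS X (-2 / (n : ℝ))).fun_smul (hasDerivAt_line S X)
  refine h.congr_deriv ?_
  simp only [zero_smul, add_zero]
  module

theorem fderiv_fderiv_sigma2_apply {S : Sym n} (hS : S ∈ SymPos n) (X Y : Sym n) :
    fderiv ℝ (fderiv ℝ sigma2) S X Y = (S : Matrix (Fin n) (Fin n) ℝ).det ^ (-2 / (n : ℝ)) •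
      (-(2 / (n : ℝ) * (invMul S X).trace) • (Y - (2 / (n : ℝ) * (invMul S Y).trace) • S)
        + (2 / (n : ℝ) * (invMul S X * invMul S Y).trace) • S
        - (2 / (n : ℝ) * (invMul S Y).trace) • X) := by
  have h0 := fderiv_fderiv_apply isOpen_symPos contDiffOn_sigma2 hS (differentiableAt_const Y) X
  rw [fderiv_fun_const, Pi.zero_apply, zero_apply, map_zero, add_zero] at h0
  rw [← h0]
  apply fderiv_apply_eq_of_hasDerivAt isOpen_symPos
    (contDiffOn_fderiv_apply isOpen_symPos contDiffOn_sigma2 (isVectorField_const Y)) hS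
  have h := (hasDerivAt_det_rpow_line hS X (-2 / (n : ℝ))).fun_smul
    ((((hasDerivAt_trace_invMul_line hS X Y).const_mul (2 / (n : ℝ))).fun_smul
      (hasDerivAt_line S X)).const_sub Y)
  have he : (fun t : ℝ => fderiv ℝ sigma2 (S + t • X) Y) =ᶠ[nhds 0] fun t : ℝ =>
      ((S + t • X : Sym n) : Matrix (Fin n) (Fin n) ℝ).det ^ (-2 / (n : ℝ)) •
        (Y - (2 / (n : ℝ) * (invMul (S + t • X) Y).trace) • (S + t • X)) := by
    have hm : ∀ᶠ t : ℝ in nhds 0, S + t • X ∈ SymPos n :=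
      (hasDerivAt_line S X).continuousAt.eventually_mem
        (by simpa using isOpen_symPos.mem_nhds hS)
    filter_upwards [hm] with t ht using fderiv_sigma2_apply ht Y
  refine HasDerivAt.congr_of_eventuallyEq ?_ he
  convert h using 1
  simp only [zero_smul, add_zero]
  module

theorem bijective_fderiv_sigma2 (hn : 1 ≤ n) {S : Sym n} (hS : S ∈ SymPos n) :
    Function.Bijective (fderiv ℝ sigma2 S) := by
  have hn' : (n : ℝ) ≠ 0 := by positivity
  have hi : Function.Injective (fderiv ℝ sigma2 S) := by
    rw [injective_iff_map_eq_zero]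
    intro X hX
    rw [fderiv_sigma2_apply hS] at hX
    have h1 := (smul_eq_zero.mp hX).resolve_left (Real.rpow_pos_of_pos (det_pos_of_mem hS) _).ne'
    have h2 : (invMul S X).trace = 0 := by
      have := congrArg (fun Y => (invMul S Y).trace) h1
      simp only [invMul_sub, invMul_smul, invMul_self hS, invMul_zero, Matrix.trace_sub,
        Matrix.trace_smul, Matrix.trace_one, Fintype.card_fin, Matrix.trace_zero,
        smul_eq_mul] at this
      field_simp at this
      linarith
    simpa [h2] using h1
  exact ⟨hi, (LinearMap.injective_iff_surjective (f := (fderiv ℝ sigma2 S : Sym n →ₗ[ℝ] Sym n))).mp hi⟩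

end MatrixCalculus

section Gaussian

open MeasureTheory ProbabilityTheory

/-! ### Moments of the standard normal distribution -/

theorem integrable_pow_gaussianReal (k : ℕ) :
    Integrable (fun x : ℝ => x ^ k) (gaussianReal 0 1) :=
  integrable_pow_of_mem_interior_integrableExpSet (X := id)
    (by rw [integrableExpSet_id_gaussianReal]; simp) k

theorem integrable_gaussianPDFReal_mul_pow (k : ℕ) :
    Integrable (fun x : ℝ => gaussianPDFReal 0 1 x * x ^ k) := by
  have h := integrable_pow_gaussianReal k
  rw [gaussianReal_of_var_ne_zero 0 one_ne_zero, integrable_withDensity_iff_integrable_smul'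
    (measurable_gaussianPDF 0 1) (ae_of_all _ fun _ => gaussianPDF_lt_top)] at h
  simpa [toReal_gaussianPDF] using h

theorem hasDerivAt_gaussianPDFReal (x : ℝ) :
    HasDerivAt (gaussianPDFReal 0 1) (-(x * gaussianPDFReal 0 1 x)) x := by
  have h : HasDerivAt (fun x : ℝ => -(x - 0) ^ 2 / (2 * ((1 : NNReal) : ℝ))) (-x) x := by
    have := (((hasDerivAt_id x).sub_const 0).pow 2).neg.div_const (2 * ((1 : NNReal) : ℝ))
    refine this.congr_deriv ?_
    simp
    ring
  refine (h.exp.const_mul (√(2 * Real.pi * ((1 : NNReal) : ℝ)))⁻¹).congr_deriv ?_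
  rw [gaussianPDFReal]
  ring

theorem integral_pow_add_two_gaussianReal (k : ℕ) :
    ∫ x, x ^ (k + 2) ∂gaussianReal 0 1 = (k + 1) * ∫ x, x ^ k ∂gaussianReal 0 1 := by
  simp only [integral_gaussianReal_eq_integral_smul (one_ne_zero : (1 : NNReal) ≠ 0), smul_eq_mul]
  have hd : ∀ x : ℝ, HasDerivAt (fun x => gaussianPDFReal 0 1 x * x ^ (k + 1))
      ((k + 1) * (gaussianPDFReal 0 1 x * x ^ k) - gaussianPDFReal 0 1 x * x ^ (k + 2)) x := by
    intro x
    refine ((hasDerivAt_gaussianPDFReal x).fun_mul (hasDerivAt_pow (k + 1) x)).congr_deriv ?_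
    push_cast
    ring_nf
  have hi := ((integrable_gaussianPDFReal_mul_pow k).const_mul ((k : ℝ) + 1)).sub
    (integrable_gaussianPDFReal_mul_pow (k + 2))
  have h := integral_eq_zero_of_hasDerivAt_of_integrable hd hi
    (integrable_gaussianPDFReal_mul_pow (k + 1))
  rw [integral_sub ((integrable_gaussianPDFReal_mul_pow k).const_mul ((k : ℝ) + 1))
    (integrable_gaussianPDFReal_mul_pow (k + 2)), integral_const_mul] at h
  linarith

theorem integral_sq_gaussianReal : ∫ x, x ^ 2 ∂gaussianReal 0 1 = 1 := by
  rw [integral_pow_add_two_gaussianReal 0]; simp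

theorem integral_pow_four_gaussianReal : ∫ x, x ^ 4 ∂gaussianReal 0 1 = 3 := by
  rw [integral_pow_add_two_gaussianReal 2, integral_sq_gaussianReal]; norm_num

theorem integral_pow_six_gaussianReal : ∫ x, x ^ 6 ∂gaussianReal 0 1 = 15 := by
  rw [integral_pow_add_two_gaussianReal 4, integral_pow_four_gaussianReal]; norm_num

/-! ### Sums of independent centred variables -/

/-- `X` is centred with finite third moment; `v` and `c` are its second and third cumulants. -/
structure HasCumulants {Ω : Type*} [MeasurableSpace Ω] (μ : Measure Ω) (X : Ω → ℝ) (v c : ℝ) :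
    Prop where
  int_one : Integrable X μ
  int_two : Integrable (fun t => X t ^ 2) μ
  int_three : Integrable (fun t => X t ^ 3) μ
  mean : ∫ t, X t ∂μ = 0
  second : ∫ t, X t ^ 2 ∂μ = v
  third : ∫ t, X t ^ 3 ∂μ = c

namespace HasCumulants

variable {Ω : Type*} [MeasurableSpace Ω] {μ : Measure Ω} {X Y : Ω → ℝ} {v c v' c' : ℝ}

theorem zero : HasCumulants μ (0 : Ω → ℝ) 0 0 := by
  constructor <;> simp

theorem const_mul (h : HasCumulants μ X v c) (a : ℝ) :
    HasCumulants μ (fun t => a * X t) (a ^ 2 * v) (a ^ 3 * c) where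
  int_one := h.int_one.const_mul a
  int_two := by simpa only [mul_pow] using h.int_two.const_mul (a ^ 2)
  int_three := by simpa only [mul_pow] using h.int_three.const_mul (a ^ 3)
  mean := by rw [integral_const_mul, h.mean, mul_zero]
  second := by simp only [mul_pow]; rw [integral_const_mul, h.second]
  third := by simp only [mul_pow]; rw [integral_const_mul, h.third]

theorem add (hX : HasCumulants μ X v c) (hY : HasCumulants μ Y v' c') (hXY : IndepFun X Y μ) :
    HasCumulants μ (X + Y) (v + v') (c + c') := by
  have hX2Y : IndepFun (fun t => X t ^ 2) Y μ :=
    hXY.comp (φ := fun x => x ^ 2) (ψ := fun x => x) (by fun_prop) (by fun_prop)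
  have hXY2 : IndepFun X (fun t => Y t ^ 2) μ :=
    hXY.comp (φ := fun x => x) (ψ := fun x => x ^ 2) (by fun_prop) (by fun_prop)
  have i11 : Integrable (fun t => X t * Y t) μ := hXY.integrable_mul hX.int_one hY.int_one
  have i21 : Integrable (fun t => X t ^ 2 * Y t) μ := hX2Y.integrable_mul hX.int_two hY.int_one
  have i12 : Integrable (fun t => X t * Y t ^ 2) μ := hXY2.integrable_mul hX.int_one hY.int_two
  have e11 : ∫ t, X t * Y t ∂μ = 0 := by
    rw [hXY.integral_fun_mul_eq_mul_integral hX.int_one.1 hY.int_one.1, hX.mean, zero_mul]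
  have e21 : ∫ t, X t ^ 2 * Y t ∂μ = 0 := by
    rw [hX2Y.integral_fun_mul_eq_mul_integral hX.int_two.1 hY.int_one.1, hY.mean, mul_zero]
  have e12 : ∫ t, X t * Y t ^ 2 ∂μ = 0 := by
    rw [hXY2.integral_fun_mul_eq_mul_integral hX.int_one.1 hY.int_two.1, hX.mean, zero_mul]
  have h2 : (fun t => (X + Y) t ^ 2) = fun t => X t ^ 2 + 2 * (X t * Y t) + Y t ^ 2 := by
    ext t; simp only [Pi.add_apply]; ring
  have h3 : (fun t => (X + Y) t ^ 3)
      = fun t => X t ^ 3 + 3 * (X t ^ 2 * Y t) + 3 * (X t * Y t ^ 2) + Y t ^ 3 := by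
    ext t; simp only [Pi.add_apply]; ring
  have j2 := hX.int_two.add (i11.const_mul 2)
  have j3 := hX.int_three.add (i21.const_mul 3)
  have j3' := j3.add (i12.const_mul 3)
  refine ⟨hX.int_one.add hY.int_one, ?_, ?_, ?_, ?_, ?_⟩
  · rw [h2]; exact j2.add hY.int_two
  · rw [h3]; exact j3'.add hY.int_three
  · simp only [Pi.add_apply]
    rw [integral_add hX.int_one hY.int_one, hX.mean, hY.mean, add_zero]
  · rw [h2, integral_add (by exact j2) hY.int_two, integral_add hX.int_two (i11.const_mul 2),
      integral_const_mul, e11, hX.second, hY.second]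
    ring
  · rw [h3, integral_add (by exact j3') hY.int_three, integral_add (by exact j3) (i12.const_mul 3),
      integral_add hX.int_three (i21.const_mul 3), integral_const_mul, integral_const_mul, e21,
      e12, hX.third, hY.third]
    ring

theorem finset_sum {ι : Type*} {X : ι → Ω → ℝ} {v c : ι → ℝ}
    (h : ∀ i, HasCumulants μ (X i) (v i) (c i)) (hm : ∀ i, Measurable (X i))
    (hX : iIndepFun X μ) (s : Finset ι) :
    HasCumulants μ (∑ i ∈ s, X i) (∑ i ∈ s, v i) (∑ i ∈ s, c i) := by
  classical
  induction s using Finset.induction_on with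
  | empty => simpa using zero
  | insert i s hi ih =>
    rw [Finset.sum_insert hi, Finset.sum_insert hi, Finset.sum_insert hi]
    exact (h i).add ih (hX.indepFun_finsetSum_of_notMem hm hi).symm

end HasCumulants

theorem hasCumulants_half_sq_sub_one :
    HasCumulants (gaussianReal 0 1) (fun z => (z ^ 2 - 1) / 2) (1 / 2) 1 := by
  have i2 := integrable_pow_gaussianReal 2
  have i4 := integrable_pow_gaussianReal 4
  have i6 := integrable_pow_gaussianReal 6
  have h2 : (fun z : ℝ => ((z ^ 2 - 1) / 2) ^ 2)
      = fun z => (1 / 4) * z ^ 4 - (1 / 2) * z ^ 2 + 1 / 4 := by ext; ring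
  have h3 : (fun z : ℝ => ((z ^ 2 - 1) / 2) ^ 3)
      = fun z => (1 / 8) * z ^ 6 - (3 / 8) * z ^ 4 + (3 / 8) * z ^ 2 - 1 / 8 := by ext; ring
  have j2 := (i4.const_mul (1 / 4)).sub (i2.const_mul (1 / 2))
  have j3 := (i6.const_mul (1 / 8)).sub (i4.const_mul (3 / 8))
  have j3' := j3.add (i2.const_mul (3 / 8))
  refine ⟨(i2.sub (integrable_const 1)).div_const 2, ?_, ?_, ?_, ?_, ?_⟩
  · rw [h2]; exact j2.add (integrable_const _)
  · rw [h3]; exact j3'.sub (integrable_const _)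
  · rw [integral_div, integral_sub i2 (integrable_const 1), integral_sq_gaussianReal]
    simp
  · rw [h2, integral_add (by exact j2) (integrable_const _),
      integral_sub (i4.const_mul _) (i2.const_mul _), integral_const_mul, integral_const_mul,
      integral_sq_gaussianReal, integral_pow_four_gaussianReal]
    simp
    norm_num
  · rw [h3, integral_sub (by exact j3') (integrable_const _),
      integral_add (by exact j3) (i2.const_mul _),
      integral_sub (i6.const_mul _) (i4.const_mul _), integral_const_mul, integral_const_mul,
      integral_const_mul, integral_sq_gaussianReal, integral_pow_four_gaussianReal,
      integral_pow_six_gaussianReal]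
    simp
    norm_num

/-- The standard normal distribution on `ℝⁿ`. -/
noncomputable def stdNormal (n : ℕ) : Measure (Fin n → ℝ) := Measure.pi fun _ => gaussianReal 0 1

instance (n : ℕ) : IsProbabilityMeasure (stdNormal n) := by
  unfold stdNormal; infer_instance

variable {n : ℕ}

theorem hasCumulants_stdNormal (l : Fin n → ℝ) :
    HasCumulants (stdNormal n) (fun z => ∑ i, l i * ((z i ^ 2 - 1) / 2))
      (∑ i, l i ^ 2 * (1 / 2)) (∑ i, l i ^ 3 * 1) := by
  have hm : ∀ i : Fin n, MeasurePreserving (fun z : Fin n → ℝ => z i) (stdNormal n)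
      (gaussianReal 0 1) := fun i => measurePreserving_eval (fun _ => gaussianReal 0 1) i
  have hcomp : ∀ i, HasCumulants (stdNormal n) (fun z : Fin n → ℝ => l i * ((z i ^ 2 - 1) / 2))
      (l i ^ 2 * (1 / 2)) (l i ^ 3 * 1) := by
    intro i
    refine HasCumulants.const_mul ?_ (l i)
    have h := hasCumulants_half_sq_sub_one
    have hint : ∀ {f : ℝ → ℝ}, Integrable f (gaussianReal 0 1) →
        ∫ z, f (z i) ∂stdNormal n = ∫ x, f x ∂gaussianReal 0 1 := fun hf =>
      integral_comp_eval (μ := fun _ : Fin n => gaussianReal 0 1) (i := i) hf.1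
    exact ⟨(hm i).integrable_comp_of_integrable h.int_one,
      (hm i).integrable_comp_of_integrable h.int_two,
      (hm i).integrable_comp_of_integrable h.int_three,
      (hint h.int_one).trans h.mean, (hint h.int_two).trans h.second,
      (hint h.int_three).trans h.third⟩
  have hind : iIndepFun (fun i (z : Fin n → ℝ) => l i * ((z i ^ 2 - 1) / 2)) (stdNormal n) :=
    iIndepFun_pi (μ := fun _ : Fin n => gaussianReal 0 1)
      (X := fun i (x : ℝ) => l i * ((x ^ 2 - 1) / 2)) fun i => by fun_prop
  have := HasCumulants.finset_sum hcomp (fun i => by fun_prop) hind Finset.univ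
  convert this using 1
  ext z
  simp

theorem stdNormal_eq_withDensity : stdNormal n = volume.withDensity
    fun z : Fin n → ℝ => ENNReal.ofReal (∏ i, gaussianPDFReal 0 1 (z i)) := by
  refine Measure.pi_eq fun s hs => ?_
  rw [withDensity_apply _ (MeasurableSet.univ_pi hs), volume_pi, Measure.restrict_pi_pi,
    ← ofReal_integral_eq_lintegral_ofReal, integral_fintype_prod_eq_prod,
    ENNReal.ofReal_prod_of_nonneg]
  · exact Finset.prod_congr rfl fun i _ =>
      (gaussianReal_apply_eq_integral 0 one_ne_zero (s i)).symm
  · exact fun i _ => integral_nonneg fun x => gaussianPDFReal_nonneg 0 1 x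
  · exact Integrable.fintype_prod fun i => (integrable_gaussianPDFReal 0 1).restrict
  · exact ae_of_all _ fun z => Finset.prod_nonneg fun i _ => gaussianPDFReal_nonneg 0 1 (z i)

theorem prod_gaussianPDFReal (z : Fin n → ℝ) :
    ∏ i, gaussianPDFReal 0 1 (z i)
      = (√((2 * Real.pi) ^ n))⁻¹ * Real.exp (-(1 / 2 : ℝ) * (z ⬝ᵥ z)) := by
  simp only [gaussianPDFReal, Finset.prod_mul_distrib, ← Real.exp_sum, Finset.prod_const,
    Finset.card_univ, Fintype.card_fin, NNReal.coe_one, mul_one, sub_zero]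
  congr 1
  · rw [inv_pow, Real.sqrt_eq_rpow, Real.sqrt_eq_rpow, ← Real.rpow_natCast,
      ← Real.rpow_natCast, ← Real.rpow_mul (by positivity), ← Real.rpow_mul (by positivity),
      mul_comm (1 / 2 : ℝ)]
  · congr 1
    rw [dotProduct, Finset.mul_sum]
    exact Finset.sum_congr rfl fun i _ => by ring

/-! ### The normal distributions as linear images of the standard one -/

theorem exists_simultaneous_diagonalization {S : Sym n} (hS : S ∈ SymPos n) (X : Sym n) :
    ∃ (P : Matrix (Fin n) (Fin n) ℝ) (l : Fin n → ℝ), IsUnit P.det ∧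
      (S : Matrix (Fin n) (Fin n) ℝ) = P * Pᵀ ∧
      (X : Matrix (Fin n) (Fin n) ℝ) = P * Matrix.diagonal l * Pᵀ := by
  open scoped MatrixOrder in
  obtain ⟨B, hB⟩ := CStarAlgebra.nonneg_iff_eq_star_mul_self.mp
    (Matrix.PosDef.posSemidef hS).nonneg
  have hB' : (S : Matrix (Fin n) (Fin n) ℝ) = Bᵀ * B := by
    rw [hB, Matrix.star_eq_conjTranspose, Matrix.conjTranspose_eq_transpose_of_trivial]
  have hdet : IsUnit B.det := by
    have := isUnit_det_of_mem hS
    rw [hB', Matrix.det_mul] at this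
    exact isUnit_of_mul_isUnit_right this
  have hdetT : IsUnit Bᵀ.det := by rwa [Matrix.det_transpose]
  have hA : (Bᵀ⁻¹ * X * B⁻¹).IsHermitian := by
    rw [Matrix.IsHermitian, Matrix.conjTranspose_eq_transpose_of_trivial, Matrix.transpose_mul,
      Matrix.transpose_mul, Matrix.transpose_nonsing_inv, Matrix.transpose_nonsing_inv,
      Matrix.transpose_transpose, Sym.transpose_coe, Matrix.mul_assoc]
  set W : Matrix (Fin n) (Fin n) ℝ := (hA.eigenvectorUnitary : Matrix (Fin n) (Fin n) ℝ)
  have hW : W * Wᵀ = 1 := by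
    have := Unitary.coe_mul_star_self hA.eigenvectorUnitary
    rwa [Unitary.coe_star, Matrix.star_eq_conjTranspose,
      Matrix.conjTranspose_eq_transpose_of_trivial] at this
  have hspec : Bᵀ⁻¹ * X * B⁻¹ = W * Matrix.diagonal hA.eigenvalues * Wᵀ := by
    have := hA.spectral_theorem
    rw [Unitary.conjStarAlgAut_apply] at this
    rwa [Matrix.star_eq_conjTranspose, Matrix.conjTranspose_eq_transpose_of_trivial] at this
  refine ⟨Bᵀ * W, hA.eigenvalues, ?_, ?_, ?_⟩
  · rw [Matrix.det_mul]
    refine hdetT.mul ?_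
    have := congrArg Matrix.det hW
    rw [Matrix.det_mul, Matrix.det_one] at this
    exact IsUnit.of_mul_eq_one _ this
  · rw [Matrix.transpose_mul, Matrix.transpose_transpose, Matrix.mul_assoc, ← Matrix.mul_assoc W,
      hW, Matrix.one_mul, hB']
  · have h : Bᵀ * W * Matrix.diagonal hA.eigenvalues * (Bᵀ * W)ᵀ
        = Bᵀ * (W * Matrix.diagonal hA.eigenvalues * Wᵀ) * B := by
      rw [Matrix.transpose_mul, Matrix.transpose_transpose]
      simp only [Matrix.mul_assoc]
    rw [h, ← hspec, Matrix.mul_assoc Bᵀ⁻¹, Matrix.mul_nonsing_inv_cancel_left _ _ hdetT,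
      Matrix.nonsing_inv_mul_cancel_right _ _ hdet]

theorem density_pos {S : Sym n} (hS : S ∈ SymPos n) (x : Fin n → ℝ) : 0 < density S x := by
  have := det_pos_of_mem hS
  unfold density
  positivity

theorem continuous_density (S : Sym n) : Continuous (density S) := by
  unfold density
  fun_prop

theorem dotProduct_inv_mulVec {S : Sym n} {P : Matrix (Fin n) (Fin n) ℝ} (hP : IsUnit P.det)
    (hSP : (S : Matrix (Fin n) (Fin n) ℝ) = P * Pᵀ) (D : Matrix (Fin n) (Fin n) ℝ)
    (z : Fin n → ℝ) :
    (P *ᵥ z) ⬝ᵥ (((S : Matrix (Fin n) (Fin n) ℝ)⁻¹ * (P * D * Pᵀ) *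
      (S : Matrix (Fin n) (Fin n) ℝ)⁻¹) *ᵥ (P *ᵥ z)) = z ⬝ᵥ (D *ᵥ z) := by
  have hPT : IsUnit Pᵀ.det := by rwa [Matrix.det_transpose]
  have h : (S : Matrix (Fin n) (Fin n) ℝ)⁻¹ * (P * D * Pᵀ) * (S : Matrix (Fin n) (Fin n) ℝ)⁻¹
      = Pᵀ⁻¹ * D * P⁻¹ := by
    rw [hSP, Matrix.mul_inv_rev]
    simp only [Matrix.mul_assoc]
    rw [Matrix.nonsing_inv_mul_cancel_left _ _ hP, Matrix.mul_nonsing_inv_cancel_left _ _ hPT]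
  rw [h, Matrix.mulVec_mulVec, Matrix.mul_assoc, Matrix.nonsing_inv_mul _ hP, Matrix.mul_one,
    Matrix.dotProduct_mulVec, ← Matrix.vecMul_transpose, Matrix.vecMul_vecMul,
    Matrix.mul_nonsing_inv_cancel_left _ _ hPT, ← Matrix.dotProduct_mulVec]

theorem density_mulVec {S : Sym n} {P : Matrix (Fin n) (Fin n) ℝ} (hP : IsUnit P.det)
    (hSP : (S : Matrix (Fin n) (Fin n) ℝ) = P * Pᵀ) (z : Fin n → ℝ) :
    |P.det| * density S (P *ᵥ z) = ∏ i, gaussianPDFReal 0 1 (z i) := by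
  have hS : IsUnit (S : Matrix (Fin n) (Fin n) ℝ).det := by
    rw [hSP, Matrix.det_mul, Matrix.det_transpose]; exact hP.mul hP
  have hq := dotProduct_inv_mulVec hP hSP 1 z
  rw [Matrix.mul_one, ← hSP, Matrix.nonsing_inv_mul _ hS, Matrix.one_mul, Matrix.one_mulVec] at hq
  rw [prod_gaussianPDFReal, density, hq, ← mul_assoc, hSP, Matrix.det_mul, Matrix.det_transpose,
    Real.sqrt_mul (by positivity), Real.sqrt_mul_self_eq_abs]
  have : |P.det| ≠ 0 := abs_ne_zero.mpr hP.ne_zero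
  congr 1
  field_simp

theorem normal_eq_map {S : Sym n} {P : Matrix (Fin n) (Fin n) ℝ} (hP : IsUnit P.det)
    (hSP : (S : Matrix (Fin n) (Fin n) ℝ) = P * Pᵀ) :
    normal S = (stdNormal n).map (fun z => P *ᵥ z) := by
  have hm : Measurable fun z : Fin n → ℝ => P *ᵥ z :=
    (Continuous.matrix_mulVec continuous_const continuous_id).measurable
  have hdm : Measurable fun x => ENNReal.ofReal (density S x) :=
    (continuous_density S).measurable.ennreal_ofReal
  have hvol : Measure.map (fun z : Fin n → ℝ => P *ᵥ z) volume
      = ENNReal.ofReal |P.det⁻¹| • volume := Real.map_matrix_volume_pi_eq_smul_volume_pi hP.ne_zero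
  have habs : |P.det⁻¹| * |P.det| = 1 := by
    rw [← abs_mul, inv_mul_cancel₀ hP.ne_zero, abs_one]
  ext s hs
  rw [Measure.map_apply hm hs, normal, withDensity_apply _ hs, stdNormal_eq_withDensity,
    withDensity_apply _ (hm hs)]
  simp only [← density_mulVec hP hSP]
  rw [← setLIntegral_map hs (f := fun x => ENNReal.ofReal (|P.det| * density S x))
    (by exact ((continuous_density S).measurable.const_mul _).ennreal_ofReal) hm, hvol,
    Measure.restrict_smul, lintegral_smul_measure, smul_eq_mul]
  simp only [ENNReal.ofReal_mul (abs_nonneg P.det)]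
  rw [lintegral_const_mul _ hdm, ← mul_assoc, ← ENNReal.ofReal_mul (abs_nonneg _), habs,
    ENNReal.ofReal_one, one_mul]

theorem isProbabilityMeasure_normal {S : Sym n} (hS : S ∈ SymPos n) :
    IsProbabilityMeasure (normal S) := by
  obtain ⟨P, l, hP, hSP, -⟩ := exists_simultaneous_diagonalization hS 0
  rw [normal_eq_map hP hSP]
  exact Measure.isProbabilityMeasure_map
    (Continuous.matrix_mulVec continuous_const continuous_id).measurable.aemeasurable

theorem integral_mul_density {S : Sym n} (hS : S ∈ SymPos n) (f : (Fin n → ℝ) → ℝ) :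
    ∫ x, f x * density S x = ∫ x, f x ∂normal S := by
  rw [normal, integral_withDensity_eq_integral_toReal_smul
    (continuous_density S).measurable.ennreal_ofReal (ae_of_all _ fun _ => ENNReal.ofReal_lt_top)]
  congr with x
  rw [ENNReal.toReal_ofReal (density_pos hS x).le, smul_eq_mul, mul_comm]

/-! ### The score -/

theorem log_density {S : Sym n} (hS : S ∈ SymPos n) (x : Fin n → ℝ) :
    Real.log (density S x) = -(1 / 2 : ℝ) * (Real.log ((2 * Real.pi) ^ n)
        + Real.log (S : Matrix (Fin n) (Fin n) ℝ).det
        + x ⬝ᵥ ((S : Matrix (Fin n) (Fin n) ℝ)⁻¹ *ᵥ x)) := by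
  have hd := det_pos_of_mem hS
  rw [density, Real.log_mul (by positivity) (Real.exp_pos _).ne', Real.log_exp, Real.log_inv,
    Real.log_sqrt (by positivity), Real.log_mul (by positivity) hd.ne']
  ring

theorem score_eq {S : Sym n} (hS : S ∈ SymPos n) (X : Sym n) (x : Fin n → ℝ) :
    score S X x = (1 / 2 : ℝ) * (x ⬝ᵥ (((S : Matrix (Fin n) (Fin n) ℝ)⁻¹ *
      (X : Matrix (Fin n) (Fin n) ℝ) * (S : Matrix (Fin n) (Fin n) ℝ)⁻¹) *ᵥ x) - (invMul S X).trace) := by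
  have hm : ∀ᶠ t : ℝ in nhds 0, S + t • X ∈ SymPos n :=
    (hasDerivAt_line S X).continuousAt.eventually_mem
      (by simpa using isOpen_symPos.mem_nhds hS)
  have he : (fun t : ℝ => Real.log (density (S + t • X) x)) =ᶠ[nhds 0] fun t =>
      -(1 / 2 : ℝ) * (Real.log ((2 * Real.pi) ^ n)
        + Real.log ((S + t • X : Sym n) : Matrix (Fin n) (Fin n) ℝ).det
        + x ⬝ᵥ (((S + t • X : Sym n) : Matrix (Fin n) (Fin n) ℝ)⁻¹ *ᵥ x)) := by
    filter_upwards [hm] with t ht using log_density ht x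
  let q : Matrix (Fin n) (Fin n) ℝ →ₗ[ℝ] ℝ :=
    { toFun := fun M => x ⬝ᵥ (M *ᵥ x)
      map_add' := fun M N => by rw [Matrix.add_mulVec, dotProduct_add]
      map_smul' := fun a M => by rw [Matrix.smul_mulVec, dotProduct_smul]; rfl }
  have hq : HasDerivAt
      (fun t : ℝ => q (((S + t • X : Sym n) : Matrix (Fin n) (Fin n) ℝ)⁻¹)) _ 0 :=
    (LinearMap.toContinuousLinearMap q).hasFDerivAt.comp_hasDerivAt 0 (hasDerivAt_inv_line hS X)
  have h := (((hasDerivAt_log_det_line hS X).const_add (Real.log ((2 * Real.pi) ^ n))).fun_add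
    hq).const_mul (-(1 / 2 : ℝ))
  have hl : HasLineDerivAt ℝ (fun T : Sym n => Real.log (density T x)) _ S X :=
    h.congr_of_eventuallyEq he
  rw [score, hl.lineDeriv, map_neg]
  change -(1 / 2 : ℝ) * (_ + -(x ⬝ᵥ (_ *ᵥ x))) = _
  ring

theorem score_add {S : Sym n} (hS : S ∈ SymPos n) (X Y : Sym n) (x : Fin n → ℝ) :
    score S (X + Y) x = score S X x + score S Y x := by
  simp only [score_eq hS, invMul_add, Matrix.trace_add, Submodule.coe_add, mul_add, add_mul,
    Matrix.add_mulVec, dotProduct_add]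
  ring

theorem trace_diagonal_conj {S X : Sym n} {P : Matrix (Fin n) (Fin n) ℝ} {l : Fin n → ℝ}
    (hP : IsUnit P.det) (hSP : (S : Matrix (Fin n) (Fin n) ℝ) = P * Pᵀ)
    (hX : (X : Matrix (Fin n) (Fin n) ℝ) = P * Matrix.diagonal l * Pᵀ) (k : ℕ) :
    (invMul S X ^ k).trace = ∑ i, l i ^ k := by
  have hPT : IsUnit Pᵀ.det := by rwa [Matrix.det_transpose]
  have h : invMul S X = Pᵀ⁻¹ * Matrix.diagonal l * Pᵀ := by
    rw [invMul, hSP, hX, Matrix.mul_inv_rev]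
    simp only [Matrix.mul_assoc]
    rw [Matrix.nonsing_inv_mul_cancel_left _ _ hP]
  have hk : invMul S X ^ k = Pᵀ⁻¹ * Matrix.diagonal l ^ k * Pᵀ := by
    induction k with
    | zero => simp [Matrix.nonsing_inv_mul _ hPT]
    | succ k ih =>
      rw [pow_succ, ih, h, pow_succ]
      simp only [Matrix.mul_assoc]
      rw [Matrix.mul_nonsing_inv_cancel_left _ _ hPT]
  rw [hk, Matrix.trace_mul_comm, ← Matrix.mul_assoc, Matrix.mul_nonsing_inv _ hPT, Matrix.one_mul,
    Matrix.diagonal_pow, Matrix.trace_diagonal]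
  rfl

theorem hasCumulants_score {S : Sym n} (hS : S ∈ SymPos n) (X : Sym n) :
    HasCumulants (normal S) (score S X) (1 / 2 * (invMul S X ^ 2).trace)
      (invMul S X ^ 3).trace := by
  obtain ⟨P, l, hP, hSP, hX⟩ := exists_simultaneous_diagonalization hS X
  have hm : Measurable fun z : Fin n → ℝ => P *ᵥ z :=
    (Continuous.matrix_mulVec continuous_const continuous_id).measurable
  have hmp : MeasurePreserving (fun z : Fin n → ℝ => P *ᵥ z) (stdNormal n) (normal S) :=
    ⟨hm, (normal_eq_map hP hSP).symm⟩
  have hcont : Continuous (score S X) := by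
    have : score S X = fun x => _ := funext (score_eq hS X)
    rw [this]
    fun_prop
  have hs : ∀ z, score S X (P *ᵥ z) = ∑ i, l i * ((z i ^ 2 - 1) / 2) := by
    intro z
    have h1 := trace_diagonal_conj hP hSP hX 1
    simp only [pow_one] at h1
    rw [score_eq hS, h1, hX, dotProduct_inv_mulVec hP hSP, dotProduct, ← Finset.sum_sub_distrib,
      Finset.mul_sum]
    refine Finset.sum_congr rfl fun i _ => ?_
    rw [Matrix.mulVec_diagonal]
    ring
  have hc := hasCumulants_stdNormal l
  have hI : ∀ k : ℕ, Integrable (fun x => score S X x ^ k) (normal S) ↔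
      Integrable (fun z => (∑ i, l i * ((z i ^ 2 - 1) / 2)) ^ k) (stdNormal n) := by
    intro k
    rw [← hmp.integrable_comp (by exact (hcont.pow k).aestronglyMeasurable)]
    simp only [Function.comp_def, hs]
  have hE : ∀ k : ℕ, ∫ x, score S X x ^ k ∂normal S
      = ∫ z, (∑ i, l i * ((z i ^ 2 - 1) / 2)) ^ k ∂stdNormal n := by
    intro k
    rw [← hmp.map_eq, integral_map hm.aemeasurable (by exact (hcont.pow k).aestronglyMeasurable)]
    simp only [hs]
  have hI1 := hI 1
  have hE1 := hE 1
  simp only [pow_one] at hI1 hE1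
  refine ⟨hI1.mpr hc.int_one, (hI 2).mpr hc.int_two, (hI 3).mpr hc.int_three,
    hE1.trans hc.mean, (hE 2).trans (hc.second.trans ?_), (hE 3).trans (hc.third.trans ?_)⟩
  · rw [trace_diagonal_conj hP hSP hX, ← Finset.sum_mul, mul_comm]
  · rw [trace_diagonal_conj hP hSP hX]; simp

theorem fisherMetric_eq {S : Sym n} (hS : S ∈ SymPos n) (X Y : Sym n) :
    fisherMetric S X Y = 1 / 2 * (invMul S X * invMul S Y).trace := by
  have hX := hasCumulants_score hS X
  have hY := hasCumulants_score hS Y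
  have hXY := hasCumulants_score hS (X + Y)
  have he : (fun x => score S X x * score S Y x) = fun x =>
      (1 / 2 : ℝ) * (score S (X + Y) x ^ 2 - score S X x ^ 2 - score S Y x ^ 2) := by
    ext x
    rw [score_add hS]
    ring
  rw [fisherMetric, integral_mul_density hS, he, integral_const_mul,
    integral_sub (by exact hXY.int_two.sub hX.int_two) hY.int_two,
    integral_sub hXY.int_two hX.int_two, hXY.second, hX.second, hY.second, invMul_add]
  simp only [pow_two, mul_add, add_mul, Matrix.trace_add]
  rw [Matrix.trace_mul_comm (invMul S Y) (invMul S X)]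
  ring

theorem amariTensor_eq (α : ℝ) {S : Sym n} (hS : S ∈ SymPos n) (X Y Z : Sym n) :
    amariTensor α S X Y Z = α * (invMul S X * invMul S Y * invMul S Z).trace := by
  have hc := hasCumulants_score hS
  have he : (fun x => score S X x * score S Y x * score S Z x) = fun x =>
      (1 / 6 : ℝ) * (score S (X + Y + Z) x ^ 3 - score S (X + Y) x ^ 3 - score S (X + Z) x ^ 3
        - score S (Y + Z) x ^ 3 + score S X x ^ 3 + score S Y x ^ 3 + score S Z x ^ 3) := by
    ext x
    simp only [score_add hS]
    ring
  have i1 := (hc (X + Y + Z)).int_three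
  have i2 := i1.sub (hc (X + Y)).int_three
  have i3 := i2.sub (hc (X + Z)).int_three
  have i4 := i3.sub (hc (Y + Z)).int_three
  have i5 := i4.add (hc X).int_three
  have i6 := i5.add (hc Y).int_three
  rw [amariTensor, integral_mul_density hS, he, integral_const_mul,
    integral_add (by exact i6) (hc Z).int_three, integral_add (by exact i5) (hc Y).int_three,
    integral_add (by exact i4) (hc X).int_three, integral_sub (by exact i3) (hc (Y + Z)).int_three,
    integral_sub (by exact i2) (hc (X + Z)).int_three, integral_sub i1 (hc (X + Y)).int_three]
  simp only [(hc _).third]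
  simp only [invMul_add, pow_three, mul_add, add_mul, Matrix.trace_add,
    ← Matrix.mul_assoc]
  have w1 := trace_invMul_mul_reverse S X Y Z
  have w2 := Matrix.trace_mul_cycle (invMul S X) (invMul S Y) (invMul S Z)
  have w3 := Matrix.trace_mul_cycle (invMul S Y) (invMul S Z) (invMul S X)
  have w4 := trace_invMul_mul_reverse S X Z Y
  have w5 := trace_invMul_mul_reverse S Z Y X
  rw [w5, w4, w3, ← w2, ← w1]
  ring

/-! ### The Kullback-Leibler divergence -/

theorem klDivergence_eq {S T : Sym n} (hS : S ∈ SymPos n) (hT : T ∈ SymPos n) :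
    klDivergence S T = (1 / 2 : ℝ) *
      (Matrix.trace ((S : Matrix (Fin n) (Fin n) ℝ) * (T : Matrix (Fin n) (Fin n) ℝ)⁻¹)
        - Real.log (Matrix.det
            ((S : Matrix (Fin n) (Fin n) ℝ) * (T : Matrix (Fin n) (Fin n) ℝ)⁻¹)) - n) := by
  have := isProbabilityMeasure_normal hS
  have := isProbabilityMeasure_normal hT
  have hdS := (continuous_density S).measurable
  have hdT := (continuous_density T).measurable
  have hwd : normal S
      = (normal T).withDensity fun x => ENNReal.ofReal (density S x / density T x) := by
    rw [normal, normal, ← withDensity_mul _ hdT.ennreal_ofReal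
      (by exact (hdS.div hdT).ennreal_ofReal)]
    congr with x
    rw [Pi.mul_apply, ← ENNReal.ofReal_mul (density_pos hT x).le,
      mul_div_cancel₀ _ (density_pos hT x).ne']
  have hac : normal S ≪ normal T := hwd ▸ withDensity_absolutelyContinuous _ _
  have hrn : (normal S).rnDeriv (normal T)
      =ᵐ[normal S] fun x => ENNReal.ofReal (density S x / density T x) := by
    refine hac.ae_eq ?_
    conv_lhs => rw [hwd]
    exact Measure.rnDeriv_withDensity _ (by exact (hdS.div hdT).ennreal_ofReal)
  have hUS := isUnit_det_of_mem hS
  have hUT := isUnit_det_of_mem hT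
  let Y : Sym n := ⟨S * (T : Matrix (Fin n) (Fin n) ℝ)⁻¹ * S - S, by
    change (_ : Matrix (Fin n) (Fin n) ℝ)ᵀ = _
    rw [Matrix.transpose_sub, Matrix.transpose_mul, Matrix.transpose_mul, Sym.transpose_coe,
      Sym.transpose_inv_coe, Matrix.mul_assoc]⟩
  have hSY : (S : Matrix (Fin n) (Fin n) ℝ)⁻¹ * Y
      = (T : Matrix (Fin n) (Fin n) ℝ)⁻¹ * S - 1 := by
    change _ * (_ - _) = _
    rw [mul_sub, Matrix.mul_assoc (S : Matrix (Fin n) (Fin n) ℝ),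
      Matrix.nonsing_inv_mul_cancel_left _ _ hUS, Matrix.nonsing_inv_mul _ hUS]
  have hSYS : (S : Matrix (Fin n) (Fin n) ℝ)⁻¹ * Y * (S : Matrix (Fin n) (Fin n) ℝ)⁻¹
      = (T : Matrix (Fin n) (Fin n) ℝ)⁻¹ - (S : Matrix (Fin n) (Fin n) ℝ)⁻¹ := by
    rw [hSY, sub_mul, one_mul, Matrix.mul_nonsing_inv_cancel_right _ _ hUS]
  have hllr : llr (normal S) (normal T) =ᵐ[normal S] fun x => score S Y x +
      (1 / 2 : ℝ) * (Matrix.trace ((T : Matrix (Fin n) (Fin n) ℝ)⁻¹ * (S : Matrix (Fin n) (Fin n) ℝ)) - n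
        - (Real.log (S : Matrix (Fin n) (Fin n) ℝ).det
          - Real.log (T : Matrix (Fin n) (Fin n) ℝ).det)) := by
    filter_upwards [hrn] with x hx
    rw [llr, hx, ENNReal.toReal_ofReal (div_pos (density_pos hS x) (density_pos hT x)).le,
      Real.log_div (density_pos hS x).ne' (density_pos hT x).ne', log_density hS, log_density hT,
      score_eq hS, hSYS, invMul, hSY, Matrix.sub_mulVec, dotProduct_sub, Matrix.trace_sub,
      Matrix.trace_one, Fintype.card_fin]
    ring
  have hc := hasCumulants_score hS Y
  rw [klDivergence, InformationTheory.toReal_klDiv_of_measure_eq hac (by simp),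
    integral_congr_ae hllr, integral_add hc.int_one (integrable_const _), hc.mean,
    integral_const, Matrix.det_mul, Matrix.det_nonsing_inv, Ring.inverse_eq_inv',
    Real.log_mul hUS.ne_zero (inv_ne_zero hUT.ne_zero), Real.log_inv, Matrix.trace_mul_comm]
  simp
  ring

end Gaussian

section Connections

variable {n : ℕ}

/-! ### The Fisher metric and the two connections -/

theorem contDiffOn_trace_invMul_mul (X Y : Sym n) :
    ContDiffOn ℝ ∞ (fun S : Sym n => (invMul S X * invMul S Y).trace) (SymPos n) :=
  contDiff_trace.comp_contDiffOn
    ((contDiffOn_invMul contDiffOn_const).mul (contDiffOn_invMul contDiffOn_const))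

theorem contDiffOn_trace_invMul (X : Sym n) :
    ContDiffOn ℝ ∞ (fun S : Sym n => (invMul S X).trace) (SymPos n) :=
  contDiff_trace.comp_contDiffOn (contDiffOn_invMul contDiffOn_const)

theorem isRiemannianMetric_fisherMetric :
    IsRiemannianMetric (SymPos n) (fisherMetric (n := n)) where
  add_smul S hS a X Y Z := by
    simp only [fisherMetric_eq hS, invMul_add, invMul_smul, add_mul, Matrix.smul_mul,
      Matrix.trace_add, Matrix.trace_smul, smul_eq_mul]
    ring
  symm S hS X Y := by
    rw [fisherMetric_eq hS, fisherMetric_eq hS, Matrix.trace_mul_comm]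
  pos S hS X hX := by
    obtain ⟨P, l, hP, hSP, hXP⟩ := exists_simultaneous_diagonalization hS X
    rw [fisherMetric_eq hS, ← pow_two, trace_diagonal_conj hP hSP hXP]
    have hl : l ≠ 0 := by
      rintro rfl
      apply hX
      apply Subtype.ext
      rw [hXP, Matrix.diagonal_eq_zero.mpr rfl]
      simp
    obtain ⟨i, hi⟩ := Function.ne_iff.mp hl
    have : 0 < ∑ i, l i ^ 2 := Finset.sum_pos' (fun i _ => sq_nonneg _)
      ⟨i, Finset.mem_univ i, by have : l i ≠ 0 := hi; positivity⟩
    positivity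
  smooth X Y := (contDiffOn_const.mul (contDiffOn_trace_invMul_mul X Y)).congr
    fun S hS => fisherMetric_eq hS X Y

theorem eventually_mem_line {S : Sym n} (hS : S ∈ SymPos n) (X : Sym n) :
    ∀ᶠ t : ℝ in nhds 0, S + t • X ∈ SymPos n :=
  (hasDerivAt_line S X).continuousAt.eventually_mem (by simpa using isOpen_symPos.mem_nhds hS)

theorem fderiv_fisherMetric {S : Sym n} (hS : S ∈ SymPos n) (X Y Z : Sym n) :
    fderiv ℝ (fun T => fisherMetric T Y Z) S X
      = -(invMul S X * invMul S Y * invMul S Z).trace := by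
  refine fderiv_apply_eq_of_hasDerivAt isOpen_symPos
    (isRiemannianMetric_fisherMetric.smooth Y Z) hS ?_
  refine (((hasDerivAt_trace_invMul_mul_line hS X Y Z).const_mul (1 / 2)).congr_of_eventuallyEq
    ?_).congr_deriv (by ring)
  filter_upwards [eventually_mem_line hS X] with t ht using fisherMetric_eq ht Y Z

/-- The symmetric matrix `X Σ⁻¹ Y + Y Σ⁻¹ X`. -/
noncomputable def jordan (S X Y : Sym n) : Sym n :=
  ⟨X * invMul S Y + Y * invMul S X, by
    change (_ : Matrix (Fin n) (Fin n) ℝ)ᵀ = _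
    simp only [invMul, Matrix.transpose_add, Matrix.transpose_mul, Sym.transpose_coe,
      Sym.transpose_inv_coe, Matrix.mul_assoc]
    rw [add_comm]⟩

theorem invMul_jordan (S X Y : Sym n) :
    invMul S (jordan S X Y) = invMul S X * invMul S Y + invMul S Y * invMul S X := by
  simp only [invMul, jordan, mul_add, Matrix.mul_assoc]

theorem fisherMetric_jordan {S : Sym n} (hS : S ∈ SymPos n) (X Y Z : Sym n) :
    fisherMetric S (jordan S X Y) Z = (invMul S X * invMul S Y * invMul S Z).trace := by
  rw [fisherMetric_eq hS, invMul_jordan, add_mul, Matrix.trace_add,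
    trace_invMul_mul_reverse S Y X Z]
  ring

theorem fisherMetric_smul_left {S : Sym n} (hS : S ∈ SymPos n) (a : ℝ) (X Z : Sym n) :
    fisherMetric S (a • X) Z = a * fisherMetric S X Z := by
  rw [fisherMetric_eq hS, fisherMetric_eq hS, invMul_smul, Matrix.smul_mul, Matrix.trace_smul,
    smul_eq_mul]
  ring

theorem leviCivita_fisherMetric {S : Sym n} (hS : S ∈ SymPos n) (X Y : Sym n) :
    leviCivita fisherMetric S X Y = -(1 / 2 : ℝ) • jordan S X Y := by
  refine (eq_sharp isRiemannianMetric_fisherMetric hS fun Z => ?_).symm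
  rw [fisherMetric_smul_left hS, fisherMetric_jordan hS, fderiv_fisherMetric hS,
    fderiv_fisherMetric hS, fderiv_fisherMetric hS, trace_invMul_mul_reverse S Y X Z,
    Matrix.trace_mul_cycle (invMul S X) (invMul S Y) (invMul S Z)]
  ring

theorem amariConnection_neg_one {S : Sym n} (hS : S ∈ SymPos n) (X Y : Sym n) :
    amariConnection (-1) S X Y = 0 := by
  have h : (1 / 2 : ℝ) • jordan S X Y
      = sharp fisherMetric S fun Z => -(1 / 2 : ℝ) * amariTensor (-1) S X Y Z := by
    refine eq_sharp isRiemannianMetric_fisherMetric hS fun Z => ?_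
    rw [fisherMetric_smul_left hS, fisherMetric_jordan hS, amariTensor_eq _ hS]
    ring
  rw [amariConnection, statConnection, leviCivita_fisherMetric hS, ← h, ← add_smul]
  simp

/-- The Christoffel form of `∇^(g^F, -C')`. -/
noncomputable def dualChristoffel (S X Y : Sym n) : Sym n :=
  -(2 / (n : ℝ)) • ((invMul S X).trace • Y + (invMul S Y).trace • X
    + (invMul S X * invMul S Y).trace • S)
    + (4 / (n : ℝ) ^ 2 * ((invMul S X).trace * (invMul S Y).trace)) • S

theorem dualConnection'_eq {S : Sym n} (hS : S ∈ SymPos n) (X Y : Sym n) :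
    dualConnection' S X Y = dualChristoffel S X Y := by
  have h : (1 / 2 : ℝ) • jordan S X Y + dualChristoffel S X Y
      = sharp fisherMetric S fun Z => -(1 / 2 : ℝ) * -tensorC' S X Y Z := by
    refine eq_sharp isRiemannianMetric_fisherMetric hS fun Z => ?_
    rw [fisherMetric_eq hS, tensorC', tensorC1, tensorC2, tensorC3]
    simp only [dualChristoffel, invMul_add, invMul_smul, invMul_jordan, invMul_self hS, add_mul,
      Matrix.smul_mul, Matrix.trace_add, Matrix.trace_smul, smul_eq_mul, Matrix.one_mul,
      smul_add]
    rw [trace_invMul_mul_reverse S Y X Z, Matrix.trace_mul_comm (invMul S Z) (invMul S X)]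
    ring
  rw [dualConnection', statConnection, leviCivita_fisherMetric hS, ← h]
  module

theorem isAffineConnection_amariConnection :
    IsAffineConnection (SymPos n) (amariConnection (n := n) (-1)) where
  add_smul_left S hS a X Y Z := by simp [amariConnection_neg_one hS]
  add_smul_right S hS a X Y Z := by simp [amariConnection_neg_one hS]
  smooth X Y := contDiffOn_const.congr fun S hS => amariConnection_neg_one hS X Y

theorem isAffineConnection_dualConnection' :
    IsAffineConnection (SymPos n) (dualConnection' (n := n)) where
  add_smul_left S hS a X Y Z := by
    simp only [dualConnection'_eq hS, dualChristoffel, invMul_add, invMul_smul, add_mul,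
      Matrix.smul_mul, Matrix.trace_add, Matrix.trace_smul, smul_eq_mul]
    module
  add_smul_right S hS a X Y Z := by
    simp only [dualConnection'_eq hS, dualChristoffel, invMul_add, invMul_smul, mul_add,
      Matrix.mul_smul, Matrix.trace_add, Matrix.trace_smul, smul_eq_mul]
    module
  smooth X Y := by
    refine ContDiffOn.congr ?_ fun S hS => dualConnection'_eq hS X Y
    have hX := contDiffOn_trace_invMul X
    have hY := contDiffOn_trace_invMul Y
    have hXY := contDiffOn_trace_invMul_mul X Y
    exact ((((hX.smul contDiffOn_const).add (hY.smul contDiffOn_const)).add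
      (hXY.smul contDiffOn_id)).const_smul _).add
      ((contDiffOn_const.mul (hX.mul hY)).smul contDiffOn_id)

/-! ### Affine coordinates and potentials -/

/-- The potential `-½ log det Σ`. -/
noncomputable def potential (S : Sym n) : ℝ :=
  -(1 / 2 : ℝ) * Real.log (S : Matrix (Fin n) (Fin n) ℝ).det

theorem contDiffOn_potential : ContDiffOn ℝ ∞ (potential (n := n)) (SymPos n) :=
  contDiffOn_const.mul (contDiffOn_det.log fun _ hS => (det_pos_of_mem hS).ne')

theorem fderiv_potential {S : Sym n} (hS : S ∈ SymPos n) (X : Sym n) :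
    fderiv ℝ potential S X = -(1 / 2 : ℝ) * (invMul S X).trace :=
  fderiv_apply_eq_of_hasDerivAt isOpen_symPos contDiffOn_potential hS
    ((hasDerivAt_log_det_line hS X).const_mul _)

theorem fderiv_fderiv_potential {S : Sym n} (hS : S ∈ SymPos n) (X Y : Sym n) :
    fderiv ℝ (fderiv ℝ potential) S X Y = fisherMetric S X Y := by
  have h0 := fderiv_fderiv_apply isOpen_symPos contDiffOn_potential hS
    (differentiableAt_const Y) X
  rw [fderiv_fun_const, Pi.zero_apply, zero_apply, map_zero, add_zero] at h0
  rw [← h0]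
  refine fderiv_apply_eq_of_hasDerivAt isOpen_symPos
    (contDiffOn_fderiv_apply isOpen_symPos contDiffOn_potential (isVectorField_const Y)) hS ?_
  refine (((hasDerivAt_trace_invMul_line hS X Y).const_mul (-(1 / 2))).congr_of_eventuallyEq
    ?_).congr_deriv (by rw [fisherMetric_eq hS]; ring)
  filter_upwards [eventually_mem_line hS X] with t ht using fderiv_potential ht Y

theorem isPotential_potential :
    IsPotential (SymPos n) fisherMetric (amariConnection (-1)) (potential (n := n)) :=
  isPotential_of_hessian isOpen_symPos contDiffOn_potential fun S hS X Y => by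
    rw [fderiv_fderiv_potential hS, amariConnection_neg_one hS, map_zero, zero_add]

theorem isAffineCoordinates_id :
    IsAffineCoordinates (SymPos n) (amariConnection (n := n) (-1)) id :=
  isAffineCoordinates_of_hessian isOpen_symPos contDiffOn_id Function.injective_id.injOn
    (fun S _ => by rw [fderiv_id]; exact Function.bijective_id) fun S hS X Y => by
      have : fderiv ℝ (id : Sym n → Sym n) = fun _ => ContinuousLinearMap.id ℝ (Sym n) := by
        ext1 T; exact fderiv_id
      rw [amariConnection_neg_one hS, this, fderiv_fun_const]
      simp

theorem trace_invMul_dualChristoffel (hn : 1 ≤ n) {S : Sym n} (hS : S ∈ SymPos n) (X Y : Sym n) :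
    (invMul S (dualChristoffel S X Y)).trace = -2 * (invMul S X * invMul S Y).trace := by
  have hn' : (n : ℝ) ≠ 0 := by positivity
  simp only [dualChristoffel, invMul_add, invMul_smul, invMul_self hS, Matrix.trace_add,
    Matrix.trace_smul, Matrix.trace_one, Fintype.card_fin, smul_eq_mul]
  field_simp
  ring

theorem isAffineCoordinates_sigma2 (hn : 1 ≤ n) :
    IsAffineCoordinates (SymPos n) (dualConnection' (n := n)) sigma2 := by
  refine isAffineCoordinates_of_hessian isOpen_symPos contDiffOn_sigma2
    (fun S hS T hT h => ?_) (fun S hS => bijective_fderiv_sigma2 hn hS) fun S hS X Y => ?_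
  · rw [← sigma2_sigma2 hn hS, h, sigma2_sigma2 hn hT]
  · rw [fderiv_fderiv_sigma2_apply hS, fderiv_sigma2_apply hS, dualConnection'_eq hS,
      trace_invMul_dualChristoffel hn hS, dualChristoffel]
    module

theorem isPotential_neg_potential (hn : 1 ≤ n) :
    IsPotential (SymPos n) fisherMetric dualConnection' (-potential (n := n)) := by
  refine isPotential_of_hessian isOpen_symPos contDiffOn_potential.neg fun S hS X Y => ?_
  have h : fderiv ℝ (-potential (n := n)) = -fderiv ℝ potential := by
    ext1 T; exact fderiv_neg
  rw [h, fderiv_neg, neg_apply, neg_apply, fderiv_fderiv_potential hS, Pi.neg_apply, neg_apply,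
    fderiv_potential hS, dualConnection'_eq hS, trace_invMul_dualChristoffel hn hS,
    fisherMetric_eq hS]
  ring

theorem isHessian_amariConnection :
    IsHessian (SymPos n) fisherMetric (amariConnection (n := n) (-1)) :=
  isAffineCoordinates_id.isHessian isOpen_symPos isRiemannianMetric_fisherMetric
    isAffineConnection_amariConnection isPotential_potential

theorem isHessian_dualConnection' (hn : 1 ≤ n) :
    IsHessian (SymPos n) fisherMetric (dualConnection' (n := n)) :=
  (isAffineCoordinates_sigma2 hn).isHessian isOpen_symPos isRiemannianMetric_fisherMetric
    isAffineConnection_dualConnection' (isPotential_neg_potential hn)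

/-! ### Canonical divergences -/

theorem exists_isGeodesicSegment_of_involution {V : Type*} [NormedAddCommGroup V]
    [NormedSpace ℝ V] {U : Set V} (hU : IsOpen U) (hc : Convex ℝ U) {x : V → V}
    (hx : ContDiffOn ℝ ∞ x U) (hm : Set.MapsTo x U U) (hxx : ∀ p ∈ U, x (x p) = p)
    {p q : V} (hp : p ∈ U) (hq : q ∈ U) : ∃ J c, IsGeodesicSegment U x p q J c := by
  let l : ℝ → V := fun t => x p + t • (x q - x p)
  have hl : ContDiff ℝ ∞ l := contDiff_const.add (contDiff_id.smul contDiff_const)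
  refine ⟨l ⁻¹' U, fun t => x (l t), hU.preimage hl.continuous, fun t ht => ?_,
    fun t ht => hm ht, hx.comp hl.contDiffOn (fun t ht => ht), fun t ht => hxx _ ht, ?_, ?_⟩
  · exact hc.add_smul_sub_mem (hm hp) (hm hq) ht
  · simp [l, hxx p hp]
  · simp [l, hxx q hq]

theorem coordDivergence_id_potential {S T : Sym n} (hS : S ∈ SymPos n)
    (hT : T ∈ SymPos n) : klDivergence S T = coordDivergence id potential S T := by
  have hUT := isUnit_det_of_mem hT
  have hUS := isUnit_det_of_mem hS
  have hinv : (fderiv ℝ (id : Sym n → Sym n) T).inverse (id T - id S) = T - S :=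
    inverse_fderiv_apply_eq (by rw [fderiv_id]; exact Function.bijective_id)
      (by rw [fderiv_id]; rfl)
  rw [coordDivergence, hinv, fderiv_potential hT, invMul_sub, invMul_self hT, klDivergence_eq hS hT,
    Matrix.det_mul, Matrix.det_nonsing_inv, Ring.inverse_eq_inv',
    Real.log_mul hUS.ne_zero (inv_ne_zero hUT.ne_zero), Real.log_inv, Matrix.trace_sub,
    Matrix.trace_one, Fintype.card_fin, Matrix.trace_mul_comm, potential, potential, invMul]
  ring

theorem isCanonicalDivergence_klDivergence :
    IsCanonicalDivergence (SymPos n) fisherMetric (amariConnection (n := n) (-1)) klDivergence :=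
  isCanonicalDivergence_of_geodesics isOpen_symPos isAffineCoordinates_id isPotential_potential
    (fun _ hp _ hq => exists_isGeodesicSegment_of_involution isOpen_symPos convex_symPos
      contDiffOn_id (Set.mapsTo_id _) (fun _ _ => rfl) hp hq)
    fun _ hS _ hT => coordDivergence_id_potential hS hT

theorem potential_sigma2 (hn : 1 ≤ n) {S : Sym n} (hS : S ∈ SymPos n) :
    potential (sigma2 S) = -potential S := by
  rw [potential, potential, det_sigma2 hn hS, Real.log_inv]
  ring

theorem isCanonicalDivergence_sigma2 (hn : 1 ≤ n) :
    IsCanonicalDivergence (SymPos n) fisherMetric (dualConnection' (n := n))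
      fun S T => klDivergence (sigma2 S) (sigma2 T) := by
  refine isCanonicalDivergence_of_geodesics isOpen_symPos (isAffineCoordinates_sigma2 hn)
    (isPotential_neg_potential hn)
    (fun _ hp _ hq => exists_isGeodesicSegment_of_involution isOpen_symPos convex_symPos
      contDiffOn_sigma2 (fun _ => sigma2_mem) (fun _ => sigma2_sigma2 hn) hp hq)
    fun S hS T hT => ?_
  have hdiff : ∀ {f : Sym n → ℝ}, ContDiffOn ℝ ∞ f (SymPos n) → ∀ {R : Sym n}, R ∈ SymPos n →
      DifferentiableAt ℝ f R := fun hf R hR =>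
    (hf.contDiffAt (isOpen_symPos.mem_nhds hR)).differentiableAt (by simp)
  obtain ⟨v, hv⟩ := (bijective_fderiv_sigma2 hn hT).2 (sigma2 T - sigma2 S)
  have hd : fderiv ℝ (-potential) T v = fderiv ℝ potential (sigma2 T) (fderiv ℝ sigma2 T v) := by
    have he : -potential (n := n) =ᶠ[nhds T] potential ∘ sigma2 := by
      filter_upwards [isOpen_symPos.mem_nhds hT] with R hR using (potential_sigma2 hn hR).symm
    rw [he.fderiv_eq, fderiv_comp T (hdiff contDiffOn_potential (sigma2_mem hT))
      ((contDiffOn_sigma2.contDiffAt (isOpen_symPos.mem_nhds hT)).differentiableAt (by simp))]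
    rfl
  have hinv : (fderiv ℝ (id : Sym n → Sym n) (sigma2 T)).inverse (id (sigma2 T) - id (sigma2 S))
      = sigma2 T - sigma2 S :=
    inverse_fderiv_apply_eq (by rw [fderiv_id]; exact Function.bijective_id)
      (by rw [fderiv_id]; rfl)
  rw [coordDivergence_id_potential (sigma2_mem hS) (sigma2_mem hT), coordDivergence,
    coordDivergence, inverse_fderiv_apply_eq (bijective_fderiv_sigma2 hn hT) hv, hd, hv, hinv,
    potential_sigma2 hn hS, potential_sigma2 hn hT, Pi.neg_apply, Pi.neg_apply]

theorem klDivergence_sigma2_eq (hn : 1 ≤ n) {S T : Sym n} (hS : S ∈ SymPos n)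
    (hT : T ∈ SymPos n) :
    klDivergence (sigma2 S) (sigma2 T) = (1 / 2 : ℝ) *
      (Matrix.det ((S : Matrix (Fin n) (Fin n) ℝ) * (T : Matrix (Fin n) (Fin n) ℝ)⁻¹)
            ^ (-2 / (n : ℝ))
          * Matrix.trace
            ((S : Matrix (Fin n) (Fin n) ℝ) * (T : Matrix (Fin n) (Fin n) ℝ)⁻¹)
        - Real.log (Matrix.det
            ((S : Matrix (Fin n) (Fin n) ℝ)⁻¹ * (T : Matrix (Fin n) (Fin n) ℝ)))
        - n) := by
  have hdS := det_pos_of_mem hS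
  have hdT := det_pos_of_mem hT
  have htr : ((sigma2 S : Matrix (Fin n) (Fin n) ℝ) * (sigma2 T : Matrix (Fin n) (Fin n) ℝ)⁻¹).trace
      = (S : Matrix (Fin n) (Fin n) ℝ).det ^ (-2 / (n : ℝ))
        * ((T : Matrix (Fin n) (Fin n) ℝ).det ^ (-2 / (n : ℝ)))⁻¹
        * ((S : Matrix (Fin n) (Fin n) ℝ) * (T : Matrix (Fin n) (Fin n) ℝ)⁻¹).trace := by
    rw [Matrix.trace_mul_comm]
    change (invMul (sigma2 T) (sigma2 S)).trace = _
    rw [sigma2, sigma2, invMul_smul, invMul_smul_left, Matrix.trace_smul, Matrix.trace_smul,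
      smul_eq_mul, smul_eq_mul, invMul, Matrix.trace_mul_comm, mul_assoc]
  rw [klDivergence_eq (sigma2_mem hS) (sigma2_mem hT), htr]
  simp only [Matrix.det_mul, Matrix.det_nonsing_inv, Ring.inverse_eq_inv', det_sigma2 hn hS,
    det_sigma2 hn hT, inv_inv]
  rw [Real.mul_rpow hdS.le (inv_nonneg.mpr hdT.le), Real.inv_rpow hdT.le]

/-! ### The action of the general linear group -/

/-- The linear map `Σ ↦ A Σ ᵗA`. -/
noncomputable def congruenceCLM (A : GL (Fin n) ℝ) : Sym n →L[ℝ] Sym n :=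
  LinearMap.toContinuousLinearMap
    { toFun := congruence A
      map_add' := fun S T => Subtype.ext (by simp [congruence, mul_add, add_mul])
      map_smul' := fun a S => Subtype.ext (by simp [congruence]) }

theorem congruence_eq_congruenceCLM (A : GL (Fin n) ℝ) : congruence A = congruenceCLM A := rfl

theorem fderiv_congruence (A : GL (Fin n) ℝ) (S X : Sym n) :
    fderiv ℝ (congruence A) S X = congruence A X := by
  rw [congruence_eq_congruenceCLM, ContinuousLinearMap.fderiv]

theorem isUnit_det_coe (A : GL (Fin n) ℝ) : IsUnit (A : Matrix (Fin n) (Fin n) ℝ).det :=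
  (Matrix.isUnit_iff_isUnit_det _).mp A.isUnit

theorem congruence_mem (A : GL (Fin n) ℝ) {S : Sym n} (hS : S ∈ SymPos n) :
    congruence A S ∈ SymPos n := by
  have h := (Matrix.IsUnit.posDef_star_right_conjugate_iff (x := (S : Matrix (Fin n) (Fin n) ℝ))
    A.isUnit).mpr hS
  rwa [Matrix.star_eq_conjTranspose, Matrix.conjTranspose_eq_transpose_of_trivial] at h

theorem invMul_congruence (A : GL (Fin n) ℝ) (S X : Sym n) :
    invMul (congruence A S) (congruence A X)
      = (A : Matrix (Fin n) (Fin n) ℝ)ᵀ⁻¹ * invMul S X * (A : Matrix (Fin n) (Fin n) ℝ)ᵀ := by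
  simp only [invMul, congruence, Matrix.mul_inv_rev, Matrix.mul_assoc]
  rw [Matrix.nonsing_inv_mul_cancel_left _ _ (isUnit_det_coe A)]

theorem trace_invMul_congruence (A : GL (Fin n) ℝ) (S X : Sym n) :
    (invMul (congruence A S) (congruence A X)).trace = (invMul S X).trace := by
  have hT : IsUnit (A : Matrix (Fin n) (Fin n) ℝ)ᵀ.det := by
    rw [Matrix.det_transpose]; exact isUnit_det_coe A
  rw [invMul_congruence, Matrix.trace_mul_comm, ← Matrix.mul_assoc, Matrix.mul_nonsing_inv _ hT,
    Matrix.one_mul]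

theorem trace_invMul_mul_congruence (A : GL (Fin n) ℝ) (S X Y : Sym n) :
    (invMul (congruence A S) (congruence A X) * invMul (congruence A S) (congruence A Y)).trace
      = (invMul S X * invMul S Y).trace := by
  have hT : IsUnit (A : Matrix (Fin n) (Fin n) ℝ)ᵀ.det := by
    rw [Matrix.det_transpose]; exact isUnit_det_coe A
  rw [invMul_congruence, invMul_congruence, Matrix.trace_mul_comm]
  simp only [Matrix.mul_assoc]
  rw [Matrix.mul_nonsing_inv_cancel_left _ _ hT, Matrix.trace_mul_comm]
  simp only [Matrix.mul_assoc]
  rw [Matrix.mul_nonsing_inv _ hT, Matrix.mul_one, Matrix.trace_mul_comm]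

theorem fisherMetric_congruence (A : GL (Fin n) ℝ) {S : Sym n} (hS : S ∈ SymPos n) (X Y : Sym n) :
    fisherMetric (congruence A S) (congruence A X) (congruence A Y) = fisherMetric S X Y := by
  rw [fisherMetric_eq (congruence_mem A hS), fisherMetric_eq hS, trace_invMul_mul_congruence]

/-- The projection of the matrices onto the symmetric ones. -/
noncomputable def symmetrize (n : ℕ) : Matrix (Fin n) (Fin n) ℝ →L[ℝ] Sym n :=
  LinearMap.toContinuousLinearMap
    { toFun := fun M => ⟨(1 / 2 : ℝ) • (M + Mᵀ), by
        change (_ : Matrix (Fin n) (Fin n) ℝ)ᵀ = _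
        rw [Matrix.transpose_smul, Matrix.transpose_add, Matrix.transpose_transpose, add_comm]⟩
      map_add' := fun M N => Subtype.ext (by
        simp only [Matrix.transpose_add, Submodule.coe_add]; module)
      map_smul' := fun a M => Subtype.ext (by
        simp only [Matrix.transpose_smul, Submodule.coe_smul, RingHom.id_apply]; module) }

theorem symmetrize_coe (S : Sym n) : symmetrize n S = S := by
  apply Subtype.ext
  change (1 / 2 : ℝ) • ((S : Matrix (Fin n) (Fin n) ℝ) + (S : Matrix (Fin n) (Fin n) ℝ)ᵀ) = S
  rw [Sym.transpose_coe]
  module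

theorem contDiff_transpose : ContDiff ℝ ∞ fun A : Matrix (Fin n) (Fin n) ℝ => Aᵀ :=
  (LinearMap.toContinuousLinearMap
    (Matrix.transposeLinearEquiv (Fin n) (Fin n) ℝ ℝ).toLinearMap).contDiff

theorem contMDiff_congruence :
    ContMDiff (𝓘(ℝ, Matrix (Fin n) (Fin n) ℝ).prod 𝓘(ℝ, Sym n)) 𝓘(ℝ, Sym n) ∞
      fun a : GL (Fin n) ℝ × Sym n => congruence a.1 a.2 := by
  have h1 : ContDiff ℝ ∞ fun a : Matrix (Fin n) (Fin n) ℝ × Sym n =>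
      symmetrize n (a.1 * (a.2 : Matrix (Fin n) (Fin n) ℝ) * a.1ᵀ) :=
    (symmetrize n).contDiff.comp ((contDiff_fst.mul (contDiff_coe.comp contDiff_snd)).mul
      (contDiff_transpose.comp contDiff_fst))
  have h2 : ContMDiff (𝓘(ℝ, Matrix (Fin n) (Fin n) ℝ).prod 𝓘(ℝ, Sym n))
      𝓘(ℝ, Matrix (Fin n) (Fin n) ℝ × Sym n) ∞
      fun a : GL (Fin n) ℝ × Sym n => ((a.1 : Matrix (Fin n) (Fin n) ℝ), a.2) :=
    (Units.contMDiff_val.comp contMDiff_fst).prodMk_space contMDiff_snd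
  refine (h1.contMDiff.comp h2).congr fun a => ?_
  exact (symmetrize_coe (congruence a.1 a.2)).symm

theorem isTransitiveSmoothAction_congruence :
    IsTransitiveSmoothAction 𝓘(ℝ, Matrix (Fin n) (Fin n) ℝ) (SymPos n) (congruence (n := n)) where
  mapsTo A _ hS := congruence_mem A hS
  one S _ := Subtype.ext (by simp [congruence])
  mul A B S _ := Subtype.ext (by simp [congruence, Matrix.mul_assoc])
  smooth := contMDiff_congruence.contMDiffOn
  transitive S hS T hT := by
    obtain ⟨P, -, hP, hSP, -⟩ := exists_simultaneous_diagonalization hS 0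
    obtain ⟨Q, -, hQ, hTQ, -⟩ := exists_simultaneous_diagonalization hT 0
    refine ⟨Matrix.GeneralLinearGroup.mk'' Q hQ * (Matrix.GeneralLinearGroup.mk'' P hP)⁻¹,
      Subtype.ext ?_⟩
    have hPT : IsUnit Pᵀ.det := by rwa [Matrix.det_transpose]
    change Q * P⁻¹ * S * (Q * P⁻¹)ᵀ = T
    rw [hSP, hTQ, Matrix.transpose_mul, Matrix.transpose_nonsing_inv]
    simp only [Matrix.mul_assoc]
    rw [Matrix.nonsing_inv_mul_cancel_left _ _ hP, Matrix.mul_nonsing_inv_cancel_left _ _ hPT]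

theorem isHomogeneousStat_congruence {Γ : Sym n → Sym n → Sym n → Sym n}
    (h : IsStatistical (SymPos n) fisherMetric Γ)
    (hΓ : ∀ A : GL (Fin n) ℝ, ∀ S ∈ SymPos n, ∀ X Y,
      Γ (congruence A S) (congruence A X) (congruence A Y) = congruence A (Γ S X Y)) :
    IsHomogeneousStat 𝓘(ℝ, Matrix (Fin n) (Fin n) ℝ) (SymPos n) fisherMetric Γ congruence where
  stat := h
  action := isTransitiveSmoothAction_congruence
  metric_invariant A S hS X Y := by
    rw [fderiv_congruence, fderiv_congruence, fisherMetric_congruence A hS]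
  connection_invariant A X Y _ hY S hS := by
    have hd : fderiv ℝ (fun T => congruence A (Y T)) S (X S)
        = congruence A (fderiv ℝ Y S (X S)) := by
      have := (congruenceCLM A).hasFDerivAt.comp S
        (hY.differentiableAt isOpen_symPos hS).hasFDerivAt
      exact congrArg (fun L => L (X S)) this.fderiv
    simp only [pullbackCov, fderiv_congruence, hΓ A S hS, hd]
    exact map_add (congruenceCLM A) _ _

theorem dualChristoffel_congruence (A : GL (Fin n) ℝ) (S X Y : Sym n) :
    dualChristoffel (congruence A S) (congruence A X) (congruence A Y)
      = congruence A (dualChristoffel S X Y) := by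
  simp only [dualChristoffel, trace_invMul_congruence, trace_invMul_mul_congruence]
  simp only [congruence_eq_congruenceCLM, map_add, map_smul]

theorem isHomogeneousStat_amariConnection :
    IsHomogeneousStat 𝓘(ℝ, Matrix (Fin n) (Fin n) ℝ) (SymPos n) fisherMetric
      (amariConnection (-1)) congruence :=
  isHomogeneousStat_congruence isHessian_amariConnection.toIsStatistical fun A S hS X Y => by
    rw [amariConnection_neg_one (congruence_mem A hS), amariConnection_neg_one hS]
    exact (map_zero (congruenceCLM A)).symm

theorem isHomogeneousStat_dualConnection' (hn : 1 ≤ n) :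
    IsHomogeneousStat 𝓘(ℝ, Matrix (Fin n) (Fin n) ℝ) (SymPos n) fisherMetric
      dualConnection' congruence :=
  isHomogeneousStat_congruence (isHessian_dualConnection' hn).toIsStatistical fun A S hS X Y => by
    rw [dualConnection'_eq (congruence_mem A hS), dualConnection'_eq hS,
      dualChristoffel_congruence]

/-! ### The isomorphism -/

/-- The endomorphism `A ↦ |det A|^(-2/n) A` of `GL(n, ℝ)`. -/
noncomputable def twist (n : ℕ) : GL (Fin n) ℝ →* GL (Fin n) ℝ :=
  MonoidHom.toHomUnits
    { toFun := fun A => |(A : Matrix (Fin n) (Fin n) ℝ).det| ^ (-2 / (n : ℝ)) •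
        (A : Matrix (Fin n) (Fin n) ℝ)
      map_one' := by simp
      map_mul' := fun A B => by
        rw [Units.val_mul, Matrix.det_mul, abs_mul, Real.mul_rpow (abs_nonneg _) (abs_nonneg _),
          Matrix.smul_mul, Matrix.mul_smul, smul_smul] }

theorem coe_twist (A : GL (Fin n) ℝ) : (twist n A : Matrix (Fin n) (Fin n) ℝ)
    = |(A : Matrix (Fin n) (Fin n) ℝ).det| ^ (-2 / (n : ℝ)) •
      (A : Matrix (Fin n) (Fin n) ℝ) := rfl

theorem twist_twist (hn : 1 ≤ n) (A : GL (Fin n) ℝ) : twist n (twist n A) = A := by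
  have hn' : (n : ℝ) ≠ 0 := by positivity
  have hd : 0 < |(A : Matrix (Fin n) (Fin n) ℝ).det| := abs_pos.mpr (isUnit_det_coe A).ne_zero
  have hdet : |(twist n A : Matrix (Fin n) (Fin n) ℝ).det|
      = |(A : Matrix (Fin n) (Fin n) ℝ).det|⁻¹ := by
    rw [coe_twist, Matrix.det_smul, Fintype.card_fin, abs_mul, ← Real.rpow_natCast,
      ← Real.rpow_mul hd.le, div_mul_cancel₀ _ hn', abs_of_pos (Real.rpow_pos_of_pos hd _),
      show (-2 : ℝ) = -((2 : ℕ) : ℝ) by norm_num, Real.rpow_neg hd.le, Real.rpow_natCast]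
    field_simp
  apply Units.ext
  rw [coe_twist, hdet, coe_twist, smul_smul, Real.inv_rpow hd.le,
    inv_mul_cancel₀ (Real.rpow_pos_of_pos hd _).ne', one_smul]

theorem contMDiff_twist : ContMDiff 𝓘(ℝ, Matrix (Fin n) (Fin n) ℝ)
    𝓘(ℝ, Matrix (Fin n) (Fin n) ℝ) ∞ (twist n) := by
  apply ContMDiff.of_comp_isOpenEmbedding Units.isOpenEmbedding_val
  intro A
  have h : ContDiffAt ℝ ∞ (fun M : Matrix (Fin n) (Fin n) ℝ => |M.det| ^ (-2 / (n : ℝ)) • M)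
      (A : Matrix (Fin n) (Fin n) ℝ) := by
    have hd := (isUnit_det_coe A).ne_zero
    exact (((contDiffAt_abs hd).comp _ contDiff_det.contDiffAt).rpow_const_of_ne
      (abs_ne_zero.mpr hd)).smul contDiffAt_id
  exact h.contMDiffAt.comp A (Units.contMDiff_val A)

theorem sigma2_congruence (A : GL (Fin n) ℝ) {S : Sym n} (hS : S ∈ SymPos n) :
    sigma2 (congruence A S) = congruence (twist n A) (sigma2 S) := by
  have hd := det_pos_of_mem hS
  have hA := abs_nonneg (A : Matrix (Fin n) (Fin n) ℝ).det
  have hdet : (congruence A S : Matrix (Fin n) (Fin n) ℝ).det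
      = |(A : Matrix (Fin n) (Fin n) ℝ).det| * |(A : Matrix (Fin n) (Fin n) ℝ).det| *
        (S : Matrix (Fin n) (Fin n) ℝ).det := by
    rw [abs_mul_abs_self]
    simp only [congruence, Matrix.det_mul, Matrix.det_transpose]
    ring
  rw [sigma2, hdet, Real.mul_rpow (mul_nonneg hA hA) hd.le, Real.mul_rpow hA hA]
  apply Subtype.ext
  simp only [congruence, sigma2, coe_twist, Submodule.coe_smul, Matrix.transpose_smul,
    Matrix.smul_mul, Matrix.mul_smul, smul_smul]
  congr 1
  ring

theorem invMul_sigma2_fderiv {S : Sym n} (hS : S ∈ SymPos n) (X : Sym n) :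
    invMul (sigma2 S) (fderiv ℝ sigma2 S X)
      = invMul S X - (2 / (n : ℝ) * (invMul S X).trace) • 1 := by
  have hu := (Real.rpow_pos_of_pos (det_pos_of_mem hS) (-2 / (n : ℝ))).ne'
  rw [fderiv_sigma2_apply hS, sigma2, invMul_smul_left, invMul_smul, smul_smul,
    inv_mul_cancel₀ hu, one_smul, invMul_sub, invMul_smul, invMul_self hS]

theorem fisherMetric_sigma2 (hn : 1 ≤ n) {S : Sym n} (hS : S ∈ SymPos n) (X Y : Sym n) :
    fisherMetric (sigma2 S) (fderiv ℝ sigma2 S X) (fderiv ℝ sigma2 S Y) = fisherMetric S X Y := by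
  have hn' : (n : ℝ) ≠ 0 := by positivity
  rw [fisherMetric_eq (sigma2_mem hS), fisherMetric_eq hS, invMul_sigma2_fderiv hS,
    invMul_sigma2_fderiv hS]
  simp only [mul_sub, sub_mul, Matrix.mul_smul,
    Matrix.smul_mul, Matrix.trace_sub, Matrix.trace_smul, Matrix.trace_one, Matrix.mul_one,
    Matrix.one_mul, Fintype.card_fin, smul_eq_mul]
  field_simp
  ring

theorem isHSMorphism_sigma2 (hn : 1 ≤ n) {Γ Γ' : Sym n → Sym n → Sym n → Sym n}
    (h : ∀ S ∈ SymPos n, ∀ X Y, fderiv ℝ (fderiv ℝ sigma2) S X Y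
      + Γ' (sigma2 S) (fderiv ℝ sigma2 S X) (fderiv ℝ sigma2 S Y)
        = fderiv ℝ sigma2 S (Γ S X Y)) :
    IsHSMorphism 𝓘(ℝ, Matrix (Fin n) (Fin n) ℝ) 𝓘(ℝ, Matrix (Fin n) (Fin n) ℝ)
      (SymPos n) fisherMetric Γ congruence (SymPos n) fisherMetric Γ' congruence
      (twist n) sigma2 where
  smooth_hom := contMDiff_twist
  immersion :=
    { mapsTo := fun _ => sigma2_mem
      smooth := contDiffOn_sigma2
      isometric := fun _ hS => fisherMetric_sigma2 hn hS
      connection := by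
        intro X Y Z _ hY _ S hS
        have hc : pullbackCov Γ' sigma2 X Y S = fderiv ℝ sigma2 S (cov Γ X Y S) := by
          rw [pullbackCov, fderiv_fderiv_apply isOpen_symPos contDiffOn_sigma2 hS
            (hY.differentiableAt isOpen_symPos hS), cov, map_add, ← h S hS]
          abel
        rw [hc, fisherMetric_sigma2 hn hS] }
  equivariant A _ hS := sigma2_congruence A hS

theorem fderiv_fderiv_sigma2_add_dualChristoffel (hn : 1 ≤ n) {S : Sym n} (hS : S ∈ SymPos n)
    (X Y : Sym n) :
    fderiv ℝ (fderiv ℝ sigma2) S X Y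
      + dualChristoffel (sigma2 S) (fderiv ℝ sigma2 S X) (fderiv ℝ sigma2 S Y) = 0 := by
  have hn' : (n : ℝ) ≠ 0 := by positivity
  have htr : ∀ X : Sym n, (invMul (sigma2 S) (fderiv ℝ sigma2 S X)).trace
      = -(invMul S X).trace := by
    intro X
    rw [invMul_sigma2_fderiv hS, Matrix.trace_sub, Matrix.trace_smul, Matrix.trace_one,
      Fintype.card_fin, smul_eq_mul]
    field_simp
    ring
  have htr2 : (invMul (sigma2 S) (fderiv ℝ sigma2 S X) *
      invMul (sigma2 S) (fderiv ℝ sigma2 S Y)).trace = (invMul S X * invMul S Y).trace := by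
    have h := fisherMetric_sigma2 hn hS X Y
    rw [fisherMetric_eq (sigma2_mem hS), fisherMetric_eq hS] at h
    linarith
  rw [dualChristoffel, htr, htr, htr2, fderiv_fderiv_sigma2_apply hS, fderiv_sigma2_apply hS,
    fderiv_sigma2_apply hS, sigma2]
  module

theorem isHSIso_sigma2 (hn : 1 ≤ n) :
    IsHSIso 𝓘(ℝ, Matrix (Fin n) (Fin n) ℝ) 𝓘(ℝ, Matrix (Fin n) (Fin n) ℝ)
      (SymPos n) fisherMetric (amariConnection (-1)) congruence
      (SymPos n) fisherMetric dualConnection' congruence (twist n) sigma2 := by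
  refine ⟨isHomogeneousStat_amariConnection, isHomogeneousStat_dualConnection' hn,
    isHSMorphism_sigma2 hn fun S hS X Y => ?_, twist n, sigma2,
    isHSMorphism_sigma2 hn fun S hS X Y => ?_, ?_, ?_,
    fun _ => sigma2_sigma2 hn, fun _ => sigma2_sigma2 hn⟩
  · rw [dualConnection'_eq (sigma2_mem hS), fderiv_fderiv_sigma2_add_dualChristoffel hn hS,
      amariConnection_neg_one hS, map_zero]
  · rw [amariConnection_neg_one (sigma2_mem hS), add_zero,
      (isAffineCoordinates_sigma2 hn).hessian_eq isOpen_symPos hS]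
  · exact MonoidHom.ext (twist_twist hn)
  · exact MonoidHom.ext (twist_twist hn)

end Connections

end InfoGeom

theorem mainTheorem7 (n : ℕ) (hn : 1 ≤ n) :
    -- both structures are Hessian
    InfoGeom.IsHessian (InfoGeom.SymPos n) InfoGeom.fisherMetric
      (InfoGeom.amariConnection (-1)) ∧
    InfoGeom.IsHessian (InfoGeom.SymPos n) InfoGeom.fisherMetric InfoGeom.dualConnection' ∧
    -- the Kullback-Leibler divergence, and its role for the first structure
    (∀ S ∈ InfoGeom.SymPos n, ∀ T ∈ InfoGeom.SymPos n,
      InfoGeom.klDivergence S T = (1 / 2 : ℝ) *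
        (Matrix.trace ((S : Matrix (Fin n) (Fin n) ℝ) * (T : Matrix (Fin n) (Fin n) ℝ)⁻¹)
          - Real.log (Matrix.det
              ((S : Matrix (Fin n) (Fin n) ℝ) * (T : Matrix (Fin n) (Fin n) ℝ)⁻¹))
          - n)) ∧
    InfoGeom.IsCanonicalDivergence (InfoGeom.SymPos n) InfoGeom.fisherMetric
      (InfoGeom.amariConnection (-1)) InfoGeom.klDivergence ∧
    -- the canonical divergence of the second structure is the pullback, and its explicit form
    InfoGeom.IsCanonicalDivergence (InfoGeom.SymPos n) InfoGeom.fisherMetric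
      InfoGeom.dualConnection'
      (fun S T => InfoGeom.klDivergence (InfoGeom.sigma2 S) (InfoGeom.sigma2 T)) ∧
    (∀ S ∈ InfoGeom.SymPos n, ∀ T ∈ InfoGeom.SymPos n,
      InfoGeom.klDivergence (InfoGeom.sigma2 S) (InfoGeom.sigma2 T) = (1 / 2 : ℝ) *
        (Matrix.det ((S : Matrix (Fin n) (Fin n) ℝ) * (T : Matrix (Fin n) (Fin n) ℝ)⁻¹)
              ^ (-2 / (n : ℝ))
            * Matrix.trace
              ((S : Matrix (Fin n) (Fin n) ℝ) * (T : Matrix (Fin n) (Fin n) ℝ)⁻¹)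
          - Real.log (Matrix.det
              ((S : Matrix (Fin n) (Fin n) ℝ)⁻¹ * (T : Matrix (Fin n) (Fin n) ℝ)))
          - n)) ∧
    -- `σ₂` induces an isomorphism of homogeneous statistical manifolds
    ∃ φ : Matrix.GeneralLinearGroup (Fin n) ℝ →* Matrix.GeneralLinearGroup (Fin n) ℝ,
      InfoGeom.IsHSIso (modelWithCornersSelf ℝ (Matrix (Fin n) (Fin n) ℝ))
        (modelWithCornersSelf ℝ (Matrix (Fin n) (Fin n) ℝ))
        (InfoGeom.SymPos n) InfoGeom.fisherMetric (InfoGeom.amariConnection (-1))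
        InfoGeom.congruence
        (InfoGeom.SymPos n) InfoGeom.fisherMetric InfoGeom.dualConnection'
        InfoGeom.congruence φ InfoGeom.sigma2 := by
  refine ⟨InfoGeom.isHessian_amariConnection, InfoGeom.isHessian_dualConnection' hn,
    fun S hS T hT => InfoGeom.klDivergence_eq hS hT, InfoGeom.isCanonicalDivergence_klDivergence,
    InfoGeom.isCanonicalDivergence_sigma2 hn,
    fun S hS T hT => InfoGeom.klDivergence_sigma2_eq hn hS hT,
    InfoGeom.twist n, InfoGeom.isHSIso_sigma2 hn⟩
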